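/- Notation. For real $\alpha,\beta$ and $n\in\mathbb N=\{0,1,2,\dots\}$ let $$P_n^{\alpha,\beta}(x)=2^{-n}\sum_{j=0}^n\binom{n+\alpha}{j}\binom{n+\beta}{n-j}(x-1)^{n-j}(x+1)^j$$ be the Jacobi polynomial (with generalized binomial coefficients), and let $(a)_j=a(a+1)\cdots(a+j-1)$. Let $\mathcal F=(F_1,F_2)$ be a pair of finite sets of positive integers, not both empty; let $k_1,k_2$ be their numbers of elements, $k=k_1+k_2$, and list the elements of each set increasingly. Put $$u_{\mathcal F}=\sum_{f\in F_1}f+\sum_{f\in F_2}f-\binom{k_1+1}{2}-\binom{k_2}{2},\qquad \sigma_{\mathcal F}=\{u_{\mathcal F},u_{\mathcal F}+1,\dots\}\setminus\{u_{\mathcal F}+f: f\in F_1\}.$$ Let $\Omega_{\mathcal F}^{\alpha,\beta}$ be the quotient by $(1+x)^{k_2(k_2-1)}$ of the determinant of the $k\times k$ matrix whose rows are, first for $f\in F_1$ and then for $f\in F_2$, $$\big((-1)^{j-1}(P_f^{\alpha,\beta})^{(j-1)}(x)\big)_{1\le j\le k},\qquad \big((\beta-f)_{j-1}(1+x)^{k-j}P_f^{\alpha+j-1,-\beta-j+1}(x)\big)_{1\le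 j\le k}.$$ For $n\in\sigma_{\mathcal F}$ let $P_n^{\alpha,\beta;\mathcal F}$ be the quotient by $(1+x)^{k_2(k_2-1)}$ of the determinant of the $(k+1)\times(k+1)$ matrix whose rows are, first the row $\big((-1)^{j-1}(P_{n-u_{\mathcal F}}^{\alpha,\beta})^{(j-1)}(x)\big)_{1\le j\le k+1}$, then for $f\in F_1$ and then for $f\in F_2$, $$\big((-1)^{j-1}(P_f^{\alpha,\beta})^{(j-1)}(x)\big)_{1\le j\le k+1},\qquad \big((\beta-f)_{j-1}(1+x)^{k-j+1}P_f^{\alpha+j-1,-\beta-j+1}(x)\big)_{1\le j\le k+1}.$$ The polynomials $P_n^{\alpha,\beta;\mathcal F}$, $n\in\sigma_{\mathcal F}$, are called exceptional Jacobi polynomials if there is a positive measure $\mu$ on $\mathbb R$ with finite moments of all orders with respect to which they are orthogonal, with positive norms, and such that their linear combinations are dense in $L^2(\mu)$. Theorem 6.3. Let $\mathcal F$ be as above and let $\alpha,\beta$ be real numbers such that $\alpha,\beta,\alpha+\beta\notin\{-1,-2,\dots\}$ and, if $F_2\ne\emptyset$, also $\alpha-\beta,\ \beta-\max F_2-1\notin\{-1,-2,\dots\}$.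 Assume that $$\alpha+k+1>0,\qquad \beta+k_1-k_2+1>0,\qquad \Omega_{\mathcal F}^{\alpha,\beta}(x)\neq0\ \text{ for all }x\in[-1,1].$$ Then both kinds of quotients above are exact, so that $\Omega_{\mathcal F}^{\alpha,\beta}$ and $P_n^{\alpha,\beta;\mathcal F}$, $n\in\sigma_{\mathcal F}$, are polynomials. The weight $$\omega_{\alpha,\beta;\mathcal F}(x)=\frac{(1-x)^{\alpha+k}(1+x)^{\beta+k_1-k_2}}{\big(\Omega_{\mathcal F}^{\alpha,\beta}(x)\big)^2},\qquad -1<x<1,$$ is positive and has finite moments of all orders; the polynomials $P_n^{\alpha,\beta;\mathcal F}$, $n\in\sigma_{\mathcal F}$, are orthogonal with respect to it, with positive norms, and their linear combinations are dense in $L^2(\omega_{\alpha,\beta;\mathcal F})$. Hence they are exceptional Jacobi polynomials. -/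

import Mathlib

open MeasureTheory Polynomial

noncomputable section

namespace ExceptionalJacobi

/-- The Jacobi polynomial `P_n^{α,β}`, with generalized binomial coefficients, so that it makes
sense for all real parameters. -/
def jacobi (n : ℕ) (α β : ℝ) : ℝ[X] :=
  C ((2 : ℝ) ^ n)⁻¹ * ∑ j ∈ Finset.range (n + 1),
    C (Ring.choose ((n : ℝ) + α) j * Ring.choose ((n : ℝ) + β) (n - j)) *
      ((X - 1) ^ (n - j) * (X + 1) ^ j)

/-- The integer `u_F = ∑_{f ∈ F₁} f + ∑_{f ∈ F₂} f - C(k₁+1, 2) - C(k₂, 2)`. The subtraction is never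
truncated when `F₁` and `F₂` consist of positive integers. -/
def uF (F₁ F₂ : Finset ℕ) : ℕ :=
  (∑ f ∈ F₁, f + ∑ f ∈ F₂, f) - ((F₁.card + 1).choose 2 + F₂.card.choose 2)

/-- The index set `σ_F = {u_F, u_F + 1, …} \ {u_F + f : f ∈ F₁}`. -/
def sigmaF (F₁ F₂ : Finset ℕ) : Set ℕ :=
  {n | uF F₁ F₂ ≤ n ∧ ∀ f ∈ F₁, n ≠ uF F₁ F₂ + f}

/-- The entry `(-1)^j (P_n^{α,β})^{(j)}`; the columns are numbered from `j = 0`. -/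
def entry₁ (α β : ℝ) (n j : ℕ) : ℝ[X] :=
  (-1) ^ j * derivative^[j] (jacobi n α β)

/-- The entry `(β - f)_j (1 + x)^(m - j) P_f^{α + j, -β - j}` in column `j = 0, …, m` of a matrix
with `m + 1` columns, where `(a)_j` is the rising factorial. -/
def entry₂ (α β : ℝ) (m f j : ℕ) : ℝ[X] :=
  C ((ascPochhammer ℝ j).eval (β - f)) * (1 + X) ^ (m - j) * jacobi f (α + j) (-β - j)

/-- The `k × k` matrix of `Ω_F`, where `k = k₁ + k₂`: the rows of `F₁` come first, then those of
`F₂`, each family in increasing order of its index. -/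
def omegaMatrix (α β : ℝ) (F₁ F₂ : Finset ℕ) :
    Matrix (Fin (F₁.card + F₂.card)) (Fin (F₁.card + F₂.card)) ℝ[X] :=
  Matrix.of (Fin.append
    (fun i j => entry₁ α β (F₁.orderEmbOfFin rfl i) j)
    (fun i j => entry₂ α β (F₁.card + F₂.card - 1) (F₂.orderEmbOfFin rfl i) j))

/-- The `(k + 1) × (k + 1)` matrix of `P_n`: its first row is that of `n - u_F`. -/
def excMatrix (α β : ℝ) (F₁ F₂ : Finset ℕ) (n : ℕ) :
    Matrix (Fin (F₁.card + F₂.card + 1)) (Fin (F₁.card + F₂.card + 1)) ℝ[X] :=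
  Matrix.of (Fin.cons
    (fun j => entry₁ α β (n - uF F₁ F₂) j)
    (Fin.append
      (fun i j => entry₁ α β (F₁.orderEmbOfFin rfl i) j)
      (fun i j => entry₂ α β (F₁.card + F₂.card) (F₂.orderEmbOfFin rfl i) j)))

/-- The polynomial `Ω_F^{α,β}`: the quotient, in the ring of polynomials, of the determinant by
`(1 + x)^(k₂ (k₂ - 1))`. -/
def omega (α β : ℝ) (F₁ F₂ : Finset ℕ) : ℝ[X] :=
  (omegaMatrix α β F₁ F₂).det / (1 + X) ^ (F₂.card * (F₂.card - 1))

/-- The polynomial `P_n^{α,β;F}`: the quotient, in the ring of polynomials, of the determinant by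
`(1 + x)^(k₂ (k₂ - 1))`. -/
def excJacobi (α β : ℝ) (F₁ F₂ : Finset ℕ) (n : ℕ) : ℝ[X] :=
  (excMatrix α β F₁ F₂ n).det / (1 + X) ^ (F₂.card * (F₂.card - 1))

/-- The weight `(1 - x)^(α + k) (1 + x)^(β + k₁ - k₂) / Ω_F(x)²`, of interest for `-1 < x < 1`. -/
def weight (α β : ℝ) (F₁ F₂ : Finset ℕ) (x : ℝ) : ℝ :=
  (1 - x) ^ (α + (F₁.card + F₂.card : ℕ)) * (1 + x) ^ (β + F₁.card - F₂.card) /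
    ((omega α β F₁ F₂).eval x) ^ 2

/-- The measure on the real line that has this weight on `(-1, 1)` and is zero outside. -/
def weightMeasure (α β : ℝ) (F₁ F₂ : Finset ℕ) : Measure ℝ :=
  (volume.restrict (Set.Ioo (-1) 1)).withDensity
    fun x => ENNReal.ofReal (weight α β F₁ F₂ x)

/-- The polynomials `p n`, `n ∈ S`, are orthogonal, with nonzero norm, with respect to the positive
measure `μ`, which has finite moments of all orders. -/
structure IsOrthogonalFamily (p : ℕ → ℝ[X]) (S : Set ℕ) (μ : Measure ℝ) : Prop where
  integrable_pow : ∀ m : ℕ, Integrable (fun x : ℝ => x ^ m) μ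
  integral_mul_eq_zero : ∀ n ∈ S, ∀ m ∈ S, n ≠ m → ∫ x, (p n).eval x * (p m).eval x ∂μ = 0
  integral_sq_pos : ∀ n ∈ S, 0 < ∫ x, (p n).eval x ^ 2 ∂μ

/-- The polynomials `p n`, `n ∈ S`, belong to `L²(μ)` and their linear combinations are dense
there. -/
structure IsCompleteFamily (p : ℕ → ℝ[X]) (S : Set ℕ) (μ : Measure ℝ) : Prop where
  memLp : ∀ n ∈ S, MemLp (fun x => (p n).eval x) 2 μ
  dense_span : Dense (Submodule.span ℝ
    {g : Lp ℝ 2 μ | ∃ n ∈ S, g =ᵐ[μ] fun x => (p n).eval x} : Set (Lp ℝ 2 μ))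

/-- The polynomials `P_n^{α,β;F}`, `n ∈ σ_F`, are exceptional Jacobi polynomials: they are orthogonal
and complete with respect to some positive measure. -/
def IsExceptionalJacobi (α β : ℝ) (F₁ F₂ : Finset ℕ) : Prop :=
  ∃ μ : Measure ℝ, IsOrthogonalFamily (excJacobi α β F₁ F₂) (sigmaF F₁ F₂) μ ∧
    IsCompleteFamily (excJacobi α β F₁ F₂) (sigmaF F₁ F₂) μ

end ExceptionalJacobi

end

open ExceptionalJacobi

/-! The construction is a Darboux–Crum transformation of the classical Jacobi operator. The seeds
`P_f^{α,β}`, `f ∈ F₁`, and `(1 + x)^(-β) P_f^{α,-β}`, `f ∈ F₂`, are eigenfunctions of that operator,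
and up to powers of `1 + x` the defining determinants are Wronskians for `-d/dx`. Let `ψ`
(`monicOp`) be the monic operator of order `k` that kills the seeds. Then `P_n = (-1)^k (1 + x)^(k₂)
Ω ψ(P_{n-u}^{α,β})`, see `coe_transform`. All this takes place in power series at `0`, where
noninteger powers of `1 + x` make sense and `Ω(0) ≠ 0` makes the Wronskian of the seeds a unit.

Orthogonality: `ψ` intertwines the Jacobi operator with another second order operator
(`exists_intertwining`). The unknown zeroth order coefficient of the latter drops out of the
Wronskian of two transformed eigenfunctions, so this Wronskian satisfies a first order equation
(`concomitant_monicOp`, `transform_concomitant`). With its integrating factor, the equation says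
that weight times `P_n P_m` is, up to a nonzero constant, the derivative of a function that vanishes
at `±1`.

Positive norms: an eigenfunction killed by `ψ` is a constant combination of seeds, hence zero if its
eigenvalue differs from all of theirs (`eq_zero_of_monicOp_eq_zero`).

Completeness: variation of parameters solves `ψ(p) = det · r` with a polynomial `p` for every
polynomial `r` (`exists_monicOp_eq`). So the span of the `P_n` contains an ideal `Q ℝ[x]` with `Q ≠
0`. If `g` is orthogonal to that ideal, then `Q g` is orthogonal to all polynomials, so it vanishes
by Weierstrass approximation, and so does `g`.

Exactness of the quotients is separate: the `F₂` rows are expanded in powers of `1 + x` and the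
exponents counted (`one_add_X_pow_dvd_det`). -/

open MeasureTheory Polynomial

noncomputable section

namespace ExceptionalJacobi

/-! ### Orders of differential operators over a derivation -/

section DifferentialAlgebra

variable {R A : Type*} [CommRing R] [CommRing A] [Algebra R A] (δ : Derivation R A A)

/-- The matrix of iterated derivatives of a family, whose determinant is the Wronskian. -/
def jetMatrix {n : ℕ} (φ : Fin n → A) : Matrix (Fin n) (Fin n) A :=
  Matrix.of fun i j => δ^[j] (φ i)

/-- The differential operators of order less than `n` with coefficients in `A`. -/
def diffOps (n : ℕ) : Submodule A (A → A) :=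
  Submodule.span A (Set.range fun j : Fin n => δ^[(j : ℕ)])

variable {δ}

theorem iterate_mem_diffOps {j n : ℕ} (h : j < n) : δ^[j] ∈ diffOps δ n :=
  Submodule.subset_span ⟨⟨j, h⟩, rfl⟩

theorem diffOps_mono {m n : ℕ} (h : m ≤ n) : diffOps δ m ≤ diffOps δ n :=
  Submodule.span_le.2 <| by
    rintro _ ⟨j, rfl⟩
    exact iterate_mem_diffOps (j.2.trans_le h)

theorem mem_diffOps_iff {n : ℕ} {E : A → A} :
    E ∈ diffOps δ n ↔ ∃ c : Fin n → A, ∀ a, E a = ∑ j, c j * δ^[(j : ℕ)] a := by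
  rw [diffOps, Submodule.mem_span_range_iff_exists_fun]
  refine exists_congr fun c => ?_
  rw [eq_comm, funext_iff]
  simp [Finset.sum_apply]

theorem diffOps_induction {n : ℕ} {p : (A → A) → Prop} (basis : ∀ j < n, p δ^[j])
    (zero : p 0) (add : ∀ E F, p E → p F → p (E + F)) (smul : ∀ (c : A) E, p E → p (c • E))
    {E : A → A} (hE : E ∈ diffOps δ n) : p E := by
  refine Submodule.span_induction (p := fun E _ => p E) ?_ zero (fun E F _ _ => add E F)
    (fun c E _ => smul c E) hE
  rintro _ ⟨j, rfl⟩
  exact basis j j.2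

theorem comp_derivation_mem_diffOps {n : ℕ} {E : A → A} (hE : E ∈ diffOps δ n) :
    (fun a => E (δ a)) ∈ diffOps δ (n + 1) := by
  refine diffOps_induction (p := fun E => (fun a => E (δ a)) ∈ diffOps δ (n + 1)) ?_ ?_ ?_ ?_ hE
  · intro j hj
    exact iterate_mem_diffOps (δ := δ) (Nat.succ_lt_succ hj)
  · exact zero_mem _
  · intro E F hE hF
    exact add_mem hE hF
  · intro c E hE
    exact Submodule.smul_mem _ c hE

theorem commutator_derivation_mem_diffOps {n : ℕ} {E : A → A} (hE : E ∈ diffOps δ n) :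
    (fun a => δ (E a) - E (δ a)) ∈ diffOps δ n := by
  -- Membership of `E` is carried along because the commutator of `δ` with `c • E` contains `δ c •
  -- E`.
  refine diffOps_induction (p := fun E => (E ∈ diffOps δ n) ∧
    (fun a => δ (E a) - E (δ a)) ∈ diffOps δ n) ?_ ?_ ?_ ?_ hE |>.2
  · intro j hj
    refine ⟨iterate_mem_diffOps hj, ?_⟩
    convert zero_mem (diffOps δ n) using 1
    funext a
    rw [← Function.iterate_succ_apply' δ, Function.iterate_succ_apply δ, sub_self]
    rfl
  · refine ⟨zero_mem _, ?_⟩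
    convert zero_mem (diffOps δ n) using 1
    funext a
    simp
  · rintro E F ⟨hE, hE'⟩ ⟨hF, hF'⟩
    refine ⟨add_mem hE hF, ?_⟩
    convert add_mem hE' hF' using 1
    funext a
    simp
    ring
  · rintro c E ⟨hE, hE'⟩
    refine ⟨Submodule.smul_mem _ c hE, ?_⟩
    convert add_mem (Submodule.smul_mem _ c hE') (Submodule.smul_mem _ (δ c) hE) using 1
    funext a
    simp
    ring

theorem derivation_comp_mem_diffOps {n : ℕ} {E : A → A} (hE : E ∈ diffOps δ n) :
    (fun a => δ (E a)) ∈ diffOps δ (n + 1) := by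
  convert add_mem (diffOps_mono n.le_succ (commutator_derivation_mem_diffOps hE))
    (comp_derivation_mem_diffOps hE) using 1
  funext a
  simp

theorem commutator_iterate_mem_diffOps (c : A) (n : ℕ) :
    (fun a => δ^[n] (c * a) - c * δ^[n] a) ∈ diffOps δ n := by
  induction n generalizing c with
  | zero =>
    convert zero_mem (diffOps δ 0) using 1
    funext a
    simp
  | succ n ih =>
    convert add_mem (add_mem (comp_derivation_mem_diffOps (ih c))
      (diffOps_mono n.le_succ (ih (δ c))))
      (Submodule.smul_mem _ (δ c) (iterate_mem_diffOps n.lt_succ_self)) using 1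
    funext a
    simp [Function.iterate_succ_apply, iterate_map_add, mul_comm]
    ring_nf

/-- The Leibniz rule with its first two terms made explicit. The second one is the source of the
shift `k * δ σ` in `exists_intertwining`. -/
theorem iterate_mul_derivation_mem_diffOps (c : A) (n : ℕ) :
    (fun a => δ^[n] (c * δ a) - c * δ^[n] (δ a) - n * δ c * δ^[n] a) ∈ diffOps δ n := by
  induction n with
  | zero =>
    convert zero_mem (diffOps δ 0) using 1
    funext a
    simp
  | succ n ih =>
    convert add_mem (derivation_comp_mem_diffOps ih)
      (Submodule.smul_mem _ (n * δ (δ c)) (iterate_mem_diffOps n.lt_succ_self)) using 1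
    funext a
    simp only [Function.iterate_succ_apply', Pi.add_apply, Pi.smul_apply, smul_eq_mul, map_sub,
      Derivation.leibniz, Derivation.map_natCast, mul_zero, add_zero, Nat.cast_succ]
    have h : δ^[n] (δ a) = δ (δ^[n] a) := by
      rw [← Function.iterate_succ_apply, Function.iterate_succ_apply']
    rw [h]
    ring

theorem comp_mul_mem_diffOps (c : A) {n : ℕ} {E : A → A} (hE : E ∈ diffOps δ n) :
    (fun a => E (c * a)) ∈ diffOps δ n := by
  refine diffOps_induction (p := fun E => (fun a => E (c * a)) ∈ diffOps δ n) ?_ ?_ ?_ ?_ hE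
  · intro j hj
    convert add_mem (diffOps_mono hj.le (commutator_iterate_mem_diffOps c j))
      (Submodule.smul_mem _ c (iterate_mem_diffOps hj)) using 1
    funext a
    simp
  · exact zero_mem _
  · intro E F hE hF
    exact add_mem hE hF
  · intro c E hE
    exact Submodule.smul_mem _ c hE

theorem commutator_mul_comp_derivation_mem_diffOps (c : A) {n : ℕ} {E : A → A}
    (hE : E ∈ diffOps δ n) : (fun a => E (c * δ a) - c * E (δ a)) ∈ diffOps δ n := by
  refine diffOps_induction
    (p := fun E => (fun a => E (c * δ a) - c * E (δ a)) ∈ diffOps δ n) ?_ ?_ ?_ ?_ hE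
  · intro j hj
    exact diffOps_mono (Nat.succ_le_of_lt hj)
      (comp_derivation_mem_diffOps (commutator_iterate_mem_diffOps c j))
  · convert zero_mem (diffOps δ n) using 1
    funext a
    simp
  · intro E F hE hF
    convert add_mem hE hF using 1
    funext a
    simp
    ring
  · intro d E hE
    convert Submodule.smul_mem _ d hE using 1
    funext a
    simp
    ring

/-! ### The monic operator with prescribed kernel, and the Darboux–Crum intertwining -/

section Monic

variable (δ) {k : ℕ} (φ : Fin k → A)

/-- The monic differential operator of order `k` that annihilates the `k` elements `φ i`, if their
Wronskian is invertible. -/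
def monicOp (a : A) : A :=
  δ^[k] a - ∑ j : Fin k, ((jetMatrix δ φ)⁻¹.mulVec fun i => δ^[k] (φ i)) j * δ^[(j : ℕ)] a

variable {δ φ}

theorem monicOp_add (a b : A) : monicOp δ φ (a + b) = monicOp δ φ a + monicOp δ φ b := by
  simp only [monicOp, iterate_map_add, mul_add, Finset.sum_add_distrib]
  ring

theorem iterate_derivation_mul_of_const {c : A} (hc : δ c = 0) (n : ℕ) (a : A) :
    δ^[n] (c * a) = c * δ^[n] a := by
  induction n with
  | zero => rfl
  | succ n ih => simp [Function.iterate_succ_apply', ih, hc]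

theorem monicOp_const_mul {c : A} (hc : δ c = 0) (a : A) :
    monicOp δ φ (c * a) = c * monicOp δ φ a := by
  simp only [monicOp, iterate_derivation_mul_of_const hc, mul_sub, Finset.mul_sum, mul_left_comm]

theorem iterate_derivation_sum {ι : Type*} (s : Finset ι) (f : ι → A) (n : ℕ) :
    δ^[n] (∑ i ∈ s, f i) = ∑ i ∈ s, δ^[n] (f i) := by
  induction n with
  | zero => rfl
  | succ n ih => simp [Function.iterate_succ_apply', ih]

theorem eq_zero_of_sum_mul_iterate_eq_zero (hW : IsUnit (jetMatrix δ φ).det) {c : Fin k → A}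
    (h : ∀ i, ∑ j, c j * δ^[(j : ℕ)] (φ i) = 0) : c = 0 := by
  have h0 : (jetMatrix δ φ).mulVec c = 0 := by
    funext i
    simpa [Matrix.mulVec, dotProduct, jetMatrix, mul_comm] using h i
  have := congrArg (jetMatrix δ φ)⁻¹.mulVec h0
  rwa [Matrix.mulVec_mulVec, Matrix.nonsing_inv_mul _ hW, Matrix.one_mulVec,
    Matrix.mulVec_zero] at this

theorem eq_zero_of_sum_mul_iterate_eq_zero' (hW : IsUnit (jetMatrix δ φ).det) {c : Fin k → A}
    (h : ∀ j : Fin k, ∑ i, c i * δ^[(j : ℕ)] (φ i) = 0) : c = 0 := by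
  have h0 : Matrix.vecMul c (jetMatrix δ φ) = 0 := by
    funext i
    simpa [Matrix.vecMul, dotProduct, jetMatrix] using h i
  have := congrArg (fun v => Matrix.vecMul v (jetMatrix δ φ)⁻¹) h0
  simpa [Matrix.vecMul_vecMul, Matrix.mul_nonsing_inv _ hW] using this

theorem monicOp_apply_self (hW : IsUnit (jetMatrix δ φ).det) (i : Fin k) :
    monicOp δ φ (φ i) = 0 := by
  have h : (jetMatrix δ φ).mulVec ((jetMatrix δ φ)⁻¹.mulVec fun i => δ^[k] (φ i)) =
      fun i => δ^[k] (φ i) := by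
    rw [Matrix.mulVec_mulVec, Matrix.mul_nonsing_inv _ hW, Matrix.one_mulVec]
  have hi := congrFun h i
  rw [monicOp, sub_eq_zero, ← hi]
  simp only [Matrix.mulVec, dotProduct, jetMatrix, Matrix.of_apply]
  exact Finset.sum_congr rfl fun j _ => mul_comm _ _

/-- The Wronskian of `a` and the family `φ`. -/
theorem det_jetMatrix_cons (hW : IsUnit (jetMatrix δ φ).det) (a : A) :
    (jetMatrix δ (Fin.cons a φ : Fin (k + 1) → A)).det =
      (-1) ^ k * monicOp δ φ a * (jetMatrix δ φ).det := by
  set N := jetMatrix δ (Fin.cons a φ : Fin (k + 1) → A) with hN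
  set s := (jetMatrix δ φ)⁻¹.mulVec fun i => δ^[k] (φ i) with hs
  -- These are the coefficients of `monicOp`. The column operation that they define turns the last
  -- column into the values of `monicOp`, of which only the top one is nonzero.
  set c : Fin (k + 1) → A := Fin.snoc (fun j => -s j) 1 with hc
  have hcol : ∀ b : A, ∑ j : Fin (k + 1), c j * δ^[(j : ℕ)] b = monicOp δ φ b := by
    intro b
    rw [Fin.sum_univ_castSucc]
    simp only [hc, Fin.snoc_castSucc, Fin.snoc_last, Fin.val_castSucc, Fin.val_last, monicOp, ← hs,
      neg_mul, Finset.sum_neg_distrib]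
    ring
  have h1 : (N.updateCol (Fin.last k) fun i => ∑ j, c j • N i j).det = N.det := by
    rw [Matrix.det_updateCol_sum]
    simp [hc]
  rw [← h1, Matrix.det_succ_column _ (Fin.last k), Fin.sum_univ_succ, Finset.sum_eq_zero]
  · have h2 : (N.updateCol (Fin.last k) fun i => ∑ j, c j • N i j).submatrix
        (Fin.succAbove 0) (Fin.last k).succAbove = jetMatrix δ φ := by
      ext i j
      simp [hN, jetMatrix, (Fin.castSucc_lt_last j).ne]
    rw [h2]
    simp [hN, jetMatrix, hcol]
  · intro i _
    simp [hN, jetMatrix, hcol, monicOp_apply_self hW]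

/-- The monic operator intertwines two second order operators, if its kernel is spanned by
eigenfunctions of the first one. -/
theorem exists_intertwining (hW : IsUnit (jetMatrix δ φ).det) (σ τ : A) (ev : Fin k → A)
    (hev : ∀ i, δ (ev i) = 0) (hφ : ∀ i, σ * δ (δ (φ i)) + τ * δ (φ i) = ev i * φ i) :
    ∃ v : A, ∀ a, σ * δ (δ (monicOp δ φ a)) + (τ + k * δ σ) * δ (monicOp δ φ a) =
      monicOp δ φ (σ * δ (δ a) + τ * δ a) + v * monicOp δ φ a := by
  set r : A → A := fun a => monicOp δ φ a - δ^[k] a with hr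
  have hrmem : r ∈ diffOps δ k := by
    rw [mem_diffOps_iff]
    exact ⟨fun j => -((jetMatrix δ φ)⁻¹.mulVec fun i => δ^[k] (φ i)) j, fun a => by
      simp [hr, monicOp]⟩
  have hψ : ∀ a, monicOp δ φ a = δ^[k] a + r a := fun a => by simp [hr]
  -- The terms of orders `k + 2` and `k + 1` cancel, the latter thanks to `k * δ σ`, so `E` has
  -- order at most `k`.
  set E : A → A := fun a => σ * δ (δ (monicOp δ φ a)) + (τ + k * δ σ) * δ (monicOp δ φ a) -
      monicOp δ φ (σ * δ (δ a) + τ * δ a) with hE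
  have hEmem : E ∈ diffOps δ (k + 1) := by
    have e1 := Submodule.smul_mem _ σ (derivation_comp_mem_diffOps
      (commutator_derivation_mem_diffOps hrmem))
    have e2 := Submodule.smul_mem _ σ (comp_derivation_mem_diffOps
      (commutator_derivation_mem_diffOps hrmem))
    have e3 := Submodule.smul_mem _ (τ + k * δ σ) (derivation_comp_mem_diffOps hrmem)
    have e4 := comp_derivation_mem_diffOps (iterate_mul_derivation_mem_diffOps (δ := δ) σ k)
    have e5 := comp_derivation_mem_diffOps (commutator_iterate_mem_diffOps (δ := δ) τ k)
    have e6 := comp_derivation_mem_diffOps (commutator_mul_comp_derivation_mem_diffOps σ hrmem)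
    have e7 := comp_derivation_mem_diffOps (comp_mul_mem_diffOps τ hrmem)
    convert sub_mem (sub_mem (sub_mem (sub_mem (add_mem (add_mem e1 e2) e3) e4) e5) e6) e7 using 1
    funext a
    have h (b : A) : δ^[k] (δ b) = δ (δ^[k] b) := by
      rw [← Function.iterate_succ_apply, Function.iterate_succ_apply']
    simp only [hE, monicOp_add, Pi.add_apply, Pi.sub_apply, Pi.smul_apply, smul_eq_mul]
    simp only [hψ, map_add, map_sub, h]
    ring
  have hEφ : ∀ i, E (φ i) = 0 := by
    intro i
    simp only [hE, hφ, monicOp_apply_self hW, monicOp_const_mul (hev i)]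
    simp
  obtain ⟨c, hc⟩ := mem_diffOps_iff.1 hEmem
  set s := (jetMatrix δ φ)⁻¹.mulVec fun i => δ^[k] (φ i) with hs
  -- Division of `E` by `monicOp`. The remainder has order less than `k` and kills all `φ i`, so
  -- invertibility of the Wronskian forces it to be zero.
  have key : ∀ a, E a = c (Fin.last k) * monicOp δ φ a +
      ∑ j : Fin k, (c j.castSucc + c (Fin.last k) * s j) * δ^[(j : ℕ)] a := by
    intro a
    rw [hc, Fin.sum_univ_castSucc, monicOp]
    simp only [Fin.val_castSucc, Fin.val_last, add_mul, Finset.sum_add_distrib, mul_sub,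
      Finset.mul_sum, mul_assoc, ← hs]
    ring
  have hzero := eq_zero_of_sum_mul_iterate_eq_zero hW
    (c := fun j : Fin k => c j.castSucc + c (Fin.last k) * s j) fun i => by
      have := key (φ i)
      rw [hEφ, monicOp_apply_self hW, mul_zero, zero_add] at this
      exact this.symm
  refine ⟨c (Fin.last k), fun a => ?_⟩
  have h1 := key a
  have h2 : ∑ j : Fin k, (c j.castSucc + c (Fin.last k) * s j) * δ^[(j : ℕ)] a = 0 :=
    Finset.sum_eq_zero fun j _ => by
      have := congrFun hzero j
      simp only [Pi.zero_apply] at this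
      rw [this, zero_mul]
  rw [h2, add_zero] at h1
  rw [← h1, hE]
  ring

/-- The bilinear concomitant of two transformed eigenfunctions. -/
theorem concomitant_monicOp (hW : IsUnit (jetMatrix δ φ).det) {σ τ : A} {ev : Fin k → A}
    (hev : ∀ i, δ (ev i) = 0) (hφ : ∀ i, σ * δ (δ (φ i)) + τ * δ (φ i) = ev i * φ i)
    {a b μ ν : A} (hμ : δ μ = 0) (hν : δ ν = 0) (ha : σ * δ (δ a) + τ * δ a = μ * a)
    (hb : σ * δ (δ b) + τ * δ b = ν * b) :
    σ * δ (monicOp δ φ a * δ (monicOp δ φ b) - monicOp δ φ b * δ (monicOp δ φ a)) +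
      (τ + k * δ σ) *
        (monicOp δ φ a * δ (monicOp δ φ b) - monicOp δ φ b * δ (monicOp δ φ a)) =
      (ν - μ) * (monicOp δ φ a * monicOp δ φ b) := by
  obtain ⟨v, hv⟩ := exists_intertwining hW σ τ ev hev hφ
  have h1 := hv a
  have h2 := hv b
  rw [ha, monicOp_const_mul hμ] at h1
  rw [hb, monicOp_const_mul hν] at h2
  simp only [map_sub, Derivation.leibniz, smul_eq_mul]
  -- The potential `v` cancels in this antisymmetric combination.
  linear_combination monicOp δ φ a * h2 - monicOp δ φ b * h1

/-- The kernel of `monicOp` consists of the combinations of the `φ i` with constant coefficients.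
Applying the second order operator to such a combination multiplies each coefficient by its own
eigenvalue, and independence then separates them. -/
theorem eq_zero_of_monicOp_eq_zero (hW : IsUnit (jetMatrix δ φ).det) {σ τ : A} {ev : Fin k → A}
    (hev : ∀ i, δ (ev i) = 0) (hφ : ∀ i, σ * δ (δ (φ i)) + τ * δ (φ i) = ev i * φ i)
    {a μ : A} (hμ : δ μ = 0) (ha : σ * δ (δ a) + τ * δ a = μ * a)
    (hne : ∀ i, IsUnit (ev i - μ)) (h : monicOp δ φ a = 0) : a = 0 := by
  set c : Fin k → A := Matrix.vecMul (fun j : Fin k => δ^[(j : ℕ)] a) (jetMatrix δ φ)⁻¹ with hc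
  have hlow : ∀ j : Fin k, δ^[(j : ℕ)] a = ∑ i, c i * δ^[(j : ℕ)] (φ i) := by
    intro j
    have : Matrix.vecMul c (jetMatrix δ φ) = fun j : Fin k => δ^[(j : ℕ)] a := by
      rw [hc, Matrix.vecMul_vecMul, Matrix.nonsing_inv_mul _ hW, Matrix.vecMul_one]
    simpa [Matrix.vecMul, dotProduct, jetMatrix] using (congrFun this j).symm
  have htop : δ^[k] a = ∑ i, c i * δ^[k] (φ i) := by
    rw [monicOp, sub_eq_zero] at h
    rw [h]
    have : ∀ i, δ^[k] (φ i) = ∑ j : Fin k,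
        ((jetMatrix δ φ)⁻¹.mulVec fun i => δ^[k] (φ i)) j * δ^[(j : ℕ)] (φ i) := fun i =>
      sub_eq_zero.1 (monicOp_apply_self hW i)
    rw [Finset.sum_congr rfl fun j _ => by rw [hlow j, Finset.mul_sum], Finset.sum_comm]
    refine Finset.sum_congr rfl fun i _ => ?_
    conv_rhs => rw [this i, Finset.mul_sum]
    exact Finset.sum_congr rfl fun j _ => mul_left_comm _ _ _
  have hall : ∀ j ≤ k, δ^[j] a = ∑ i, c i * δ^[j] (φ i) := by
    intro j hj
    rcases hj.lt_or_eq with hj | rfl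
    · exact hlow ⟨j, hj⟩
    · exact htop
  -- Differentiating the relation of order `j` and subtracting that of order `j + 1` leaves a
  -- homogeneous Wronskian system for the `δ (c i)`.
  have hδc : ∀ i, δ (c i) = 0 := by
    refine congrFun (eq_zero_of_sum_mul_iterate_eq_zero' hW (c := fun i => δ (c i)) fun j => ?_)
    have h1 := congrArg δ (hall j j.2.le)
    rw [← Function.iterate_succ_apply' δ, hall _ j.2, map_sum] at h1
    simp only [Derivation.leibniz, smul_eq_mul, Finset.sum_add_distrib,
      Function.iterate_succ_apply'] at h1
    rw [left_eq_add] at h1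
    rw [← h1]
    exact Finset.sum_congr rfl fun i _ => mul_comm _ _
  have ha0 : a = ∑ i, c i * φ i := by simpa using hall 0 k.zero_le
  have hd : (fun i => c i * (ev i - μ)) = 0 := by
    refine eq_zero_of_sum_mul_iterate_eq_zero' hW fun j => ?_
    have hsum : ∑ i, c i * (ev i - μ) * φ i = 0 := by
      have h1 : δ a = ∑ i, c i * δ (φ i) := by
        conv_lhs => rw [ha0, map_sum]
        simp [hδc]
      have h2 : δ (δ a) = ∑ i, c i * δ (δ (φ i)) := by
        rw [h1, map_sum]
        simp [hδc]
      rw [h2, h1] at ha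
      conv_rhs at ha => rw [ha0]
      rw [Finset.mul_sum, Finset.mul_sum, Finset.mul_sum, ← Finset.sum_add_distrib,
        ← sub_eq_zero, ← Finset.sum_sub_distrib] at ha
      rw [← ha]
      refine Finset.sum_congr rfl fun i _ => ?_
      linear_combination -c i * hφ i
    have h3 := congrArg δ^[(j : ℕ)] hsum
    rw [iterate_derivation_sum, iterate_map_zero] at h3
    rw [← h3]
    refine Finset.sum_congr rfl fun i _ => ?_
    rw [iterate_derivation_mul_of_const]
    simp [hδc, hev, hμ]
  have hc0 : ∀ i, c i = 0 := fun i => by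
    have := congrFun hd i
    simpa using (hne i).mul_left_eq_zero.1 this
  rw [ha0]
  simp [hc0]

/-- Variation of parameters. -/
theorem monicOp_sum_mul (hW : IsUnit (jetMatrix δ φ).det) {h : Fin k → A} {g : A}
    (hh : ∀ j : Fin k, ∑ i, δ (h i) * δ^[(j : ℕ)] (φ i) = if (j : ℕ) + 1 = k then g else 0)
    (hk : 0 < k) : monicOp δ φ (∑ i, h i * φ i) = g := by
  have hlow : ∀ j < k, δ^[j] (∑ i, h i * φ i) = ∑ i, h i * δ^[j] (φ i) := by
    intro j
    induction j with
    | zero => intro; rfl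
    | succ j ih =>
      intro hj
      rw [Function.iterate_succ_apply', ih (by omega), map_sum]
      have := hh ⟨j, by omega⟩
      simp only [hj.ne, if_false] at this
      simp only [Derivation.leibniz, smul_eq_mul, Finset.sum_add_distrib,
        Function.iterate_succ_apply', add_eq_left]
      rw [← this]
      exact Finset.sum_congr rfl fun i _ => mul_comm _ _
  have htop : δ^[k] (∑ i, h i * φ i) = ∑ i, h i * δ^[k] (φ i) + g := by
    obtain ⟨m, rfl⟩ : ∃ m, k = m + 1 := ⟨k - 1, by omega⟩
    rw [Function.iterate_succ_apply', hlow m (by omega), map_sum]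
    have := hh ⟨m, by omega⟩
    simp only [if_true] at this
    simp only [Derivation.leibniz, smul_eq_mul, Finset.sum_add_distrib,
      Function.iterate_succ_apply']
    rw [← this]
    congr 1
    exact Finset.sum_congr rfl fun i _ => mul_comm _ _
  have hlow' : ∀ j : Fin k, ((jetMatrix δ φ)⁻¹.mulVec fun i => δ^[k] (φ i)) j *
      δ^[(j : ℕ)] (∑ i, h i * φ i) = ∑ i, ((jetMatrix δ φ)⁻¹.mulVec fun i => δ^[k] (φ i)) j *
      (h i * δ^[(j : ℕ)] (φ i)) := fun j => by rw [hlow j j.2, Finset.mul_sum]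
  rw [monicOp, htop, Finset.sum_congr rfl fun j _ => hlow' j, Finset.sum_comm]
  have h0 : ∀ i, δ^[k] (φ i) = ∑ j : Fin k,
      ((jetMatrix δ φ)⁻¹.mulVec fun i => δ^[k] (φ i)) j * δ^[(j : ℕ)] (φ i) := fun i =>
    sub_eq_zero.1 (monicOp_apply_self hW i)
  rw [sub_eq_iff_eq_add, add_comm, add_right_inj]
  refine Finset.sum_congr rfl fun i _ => ?_
  conv_lhs => rw [h0 i, Finset.mul_sum]
  exact Finset.sum_congr rfl fun j _ => mul_left_comm _ _ _

end Monic

end DifferentialAlgebra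

/-! ### Jacobi polynomials: differential equation, contiguous relation, degree -/

section Jacobi

theorem choose_succ_mul (r : ℝ) (j : ℕ) :
    Ring.choose r (j + 1) * (j + 1) = Ring.choose r j * (r - j) := by
  have := Ring.choose_smul_choose r (n := j + 1) (k := j) j.le_succ
  simp only [Nat.choose_succ_self_right, nsmul_eq_mul, Nat.add_sub_cancel_left,
    Ring.choose_one_right] at this
  rw [← this]
  push_cast
  ring

theorem choose_mul_sub (r : ℝ) (i : ℕ) :
    Ring.choose r i * (r - i) = r * Ring.choose (r - 1) i := by
  have := Ring.choose_smul_choose r (n := i + 1) (k := 1) (by omega)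
  simp only [Nat.choose_one_right, nsmul_eq_mul, Nat.add_sub_cancel, Ring.choose_one_right] at this
  rw [← choose_succ_mul, mul_comm]
  push_cast at this
  linarith

theorem choose_ne_zero_of_forall {r : ℝ} {n : ℕ} (h : ∀ i < n, r ≠ i) : Ring.choose r n ≠ 0 := by
  induction n with
  | zero => simp
  | succ n ih =>
    have h1 := choose_succ_mul r n
    intro h0
    rw [h0, zero_mul] at h1
    exact mul_ne_zero (ih fun i hi => h i (by omega)) (sub_ne_zero.2 (h n (by omega))) h1.symm

/-- The factor `(X - 1) * (X + 1)` avoids the exponents `i - 1` and `j - 1`, so that `0` needs no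
separate treatment later. -/
theorem mul_derivative_basis (i j : ℕ) :
    (X - 1) * (X + 1) * derivative ((X - 1) ^ i * (X + 1) ^ j : ℝ[X]) =
      ((i : ℝ[X]) * (X + 1) + (j : ℝ[X]) * (X - 1)) * ((X - 1) ^ i * (X + 1) ^ j) := by
  have hp (p : ℝ[X]) (hp : derivative p = 1) (i : ℕ) : p * derivative (p ^ i) = i * p ^ i := by
    cases i with
    | zero => simp
    | succ i =>
      rw [derivative_pow_succ, hp]
      push_cast
      simp
      ring
  have hA := hp (X - 1) (by simp) i
  have hB := hp (X + 1) (by simp) j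
  rw [derivative_mul]
  linear_combination (X + 1) * (X + 1) ^ j * hA + (X - 1) * (X - 1) ^ i * hB

theorem second_order_basis (α β : ℝ) (i j : ℕ) :
    ((X - 1) * (X + 1)) * ((X - 1) * (X + 1) *
        derivative (derivative ((X - 1) ^ i * (X + 1) ^ j : ℝ[X])) +
      (C (α + 1) * (X + 1) + C (β + 1) * (X - 1)) *
        derivative ((X - 1) ^ i * (X + 1) ^ j : ℝ[X])) =
      (C (i * (i + α)) * (X + 1) ^ 2 + C (j * (j + β)) * (X - 1) ^ 2 +
        C (2 * i * j + α * j + β * i + (i + j)) * ((X - 1) * (X + 1))) *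
        ((X - 1) ^ i * (X + 1) ^ j) := by
  have h1 := mul_derivative_basis i j
  have h2 := congrArg derivative h1
  set e : ℝ[X] := (X - 1) ^ i * (X + 1) ^ j
  simp only [derivative_mul, derivative_add, derivative_sub, derivative_X, derivative_one,
    derivative_natCast] at h2
  simp only [map_add, map_mul, map_natCast, map_one, map_ofNat]
  linear_combination ((X - 1) * (X + 1)) * h2 +
    (C α * (X + 1) + C β * (X - 1) + ((i : ℝ[X]) * (X + 1) + (j : ℝ[X]) * (X - 1))) * h1

/-- The coefficient of `(x - 1)^(n - j) (x + 1)^j` in `2^n P_n^{α,β}`. -/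
def jacobiCoeff (n : ℕ) (α β : ℝ) (j : ℕ) : ℝ :=
  Ring.choose ((n : ℝ) + α) j * Ring.choose ((n : ℝ) + β) (n - j)

/-- This two-term recurrence is the differential equation read off in the basis `(x - 1)^(n - j) (x
+ 1)^j`. -/
theorem jacobiCoeff_succ {n j : ℕ} (hj : j < n) (α β : ℝ) :
    jacobiCoeff n α β (j + 1) * ((j + 1 : ℕ) * ((j + 1 : ℕ) + β)) =
      jacobiCoeff n α β j * ((n - j : ℕ) * ((n - j : ℕ) + α)) := by
  obtain ⟨i, rfl⟩ : ∃ i, n = j + 1 + i := ⟨n - (j + 1), by omega⟩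
  have e1 : j + 1 + i - (j + 1) = i := by omega
  have e2 : j + 1 + i - j = i + 1 := by omega
  rw [jacobiCoeff, jacobiCoeff, e1, e2]
  have h1 := choose_succ_mul (((j + 1 + i : ℕ) : ℝ) + α) j
  have h2 := choose_succ_mul (((j + 1 + i : ℕ) : ℝ) + β) i
  push_cast at h1 h2 ⊢
  linear_combination Ring.choose ((j + 1 + i : ℝ) + β) i * (j + 1 + β) * h1 -
    Ring.choose ((j + 1 + i : ℝ) + α) j * (i + 1 + α) * h2

theorem jacobi_eq_sum (n : ℕ) (α β : ℝ) :
    C ((2 : ℝ) ^ n) * jacobi n α β = ∑ j ∈ Finset.range (n + 1),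
      C (jacobiCoeff n α β j) * ((X - 1) ^ (n - j) * (X + 1) ^ j) := by
  rw [jacobi, ← mul_assoc, ← C_mul, mul_inv_cancel₀ (by positivity), C_1, one_mul]
  rfl

theorem jacobi_ode (n : ℕ) (α β : ℝ) :
    (1 - X ^ 2) * derivative (derivative (jacobi n α β)) +
      (C (β - α) - C (α + β + 2) * X) * derivative (jacobi n α β) =
      -C (n * (n + α + β + 1)) * jacobi n α β := by
  set S : ℝ[X] := ∑ j ∈ Finset.range (n + 1),
      C (jacobiCoeff n α β j) * ((X - 1) ^ (n - j) * (X + 1) ^ j) with hS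
  have hne : (X - 1 : ℝ[X]) * (X + 1) ≠ 0 := mul_ne_zero (X_sub_C_ne_zero 1) (X_add_C_ne_zero 1)
  have key : (X - 1) * (X + 1) * ((X - 1) * (X + 1) * derivative (derivative S) +
      (C (α + 1) * (X + 1) + C (β + 1) * (X - 1)) * derivative S -
      C (n * (n + α + β + 1)) * S) = 0 := by
    have h1 : (X - 1) * (X + 1) * ((X - 1) * (X + 1) * derivative (derivative S) +
        (C (α + 1) * (X + 1) + C (β + 1) * (X - 1)) * derivative S -
        C (n * (n + α + β + 1)) * S) = 2 * ∑ j ∈ Finset.range (n + 1),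
        (C (jacobiCoeff n α β j * ((n - j : ℕ) * ((n - j : ℕ) + α))) *
          ((X - 1) ^ (n - j) * (X + 1) ^ (j + 1)) -
        C (jacobiCoeff n α β j * (j * (j + β))) * ((X - 1) ^ (n - j + 1) * (X + 1) ^ j)) := by
      simp only [hS, derivative_sum, Finset.mul_sum, ← Finset.sum_add_distrib,
        ← Finset.sum_sub_distrib]
      refine Finset.sum_congr rfl fun j hj => ?_
      have hj' : j ≤ n := Nat.lt_succ_iff.1 (Finset.mem_range.1 hj)
      obtain ⟨i, rfl⟩ : ∃ i, n = i + j := ⟨n - j, by omega⟩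
      rw [Nat.add_sub_cancel, derivative_C_mul, derivative_C_mul]
      have h := second_order_basis α β i j
      simp only [map_add, map_mul, map_natCast, map_one, map_ofNat, pow_succ (X - 1 : ℝ[X]) i,
        pow_succ (X + 1 : ℝ[X]) j, Nat.cast_add] at h ⊢
      linear_combination C (jacobiCoeff (i + j) α β j) * h
    -- The two sums agree after an index shift. The unmatched terms `j = n` of the first and `j = 0`
    -- of the second carry a factor zero.
    rw [h1, Finset.sum_sub_distrib, Finset.sum_range_succ, Finset.sum_range_succ', sub_eq_zero.2,
      mul_zero]
    simp only [Nat.sub_self, Nat.cast_zero, zero_mul, mul_zero, map_zero, add_zero]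
    refine Finset.sum_congr rfl fun j hj => ?_
    have hj' := Finset.mem_range.1 hj
    rw [jacobiCoeff_succ hj', show n - (j + 1) + 1 = n - j by omega]
  have h2 := (mul_eq_zero.1 key).resolve_left hne
  rw [hS, ← jacobi_eq_sum, derivative_C_mul, derivative_C_mul] at h2
  have h2n : (C ((2 : ℝ) ^ n) : ℝ[X]) ≠ 0 := by simp
  refine mul_left_cancel₀ h2n ?_
  simp only [map_add, map_sub, map_mul, map_natCast, map_one, map_ofNat] at h2 ⊢
  linear_combination -h2

/-- Equivalent to `((1 + x)^b P_n^{a,b})' = (n + b) (1 + x)^(b - 1) P_n^{a+1,b-1}`. Used with `b =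
-β - j`, it identifies the entries of the `F₂` rows as derivatives of one function. -/
theorem jacobi_shift (n : ℕ) (a b : ℝ) :
    (1 + X) * derivative (jacobi n a b) + C b * jacobi n a b =
      C (n + b) * jacobi n (a + 1) (b - 1) := by
  have h2n : (C ((2 : ℝ) ^ n) : ℝ[X]) ≠ 0 := by simp
  have hA : (X - 1 : ℝ[X]) ≠ 0 := X_sub_C_ne_zero 1
  refine mul_left_cancel₀ h2n (mul_left_cancel₀ hA ?_)
  have e1 := congrArg derivative (jacobi_eq_sum n a b)
  rw [derivative_C_mul] at e1
  have : (X - 1) * (C ((2 : ℝ) ^ n) * ((1 + X) * derivative (jacobi n a b) + C b * jacobi n a b)) =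
      (X - 1) * (1 + X) * (C ((2 : ℝ) ^ n) * derivative (jacobi n a b)) +
        (X - 1) * (C b * (C ((2 : ℝ) ^ n) * jacobi n a b)) := by ring
  rw [this, mul_left_comm (C ((2 : ℝ) ^ n)) (C ((n : ℝ) + b)), e1, jacobi_eq_sum, jacobi_eq_sum]
  simp only [derivative_sum, Finset.mul_sum]
  have hL : ∀ j ∈ Finset.range (n + 1), (X - 1) * (1 + X) *
      derivative (C (jacobiCoeff n a b j) * ((X - 1) ^ (n - j) * (X + 1) ^ j)) =
      C (jacobiCoeff n a b j * (n - j : ℕ)) * ((X - 1) ^ (n - j) * (X + 1) ^ (j + 1)) +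
      (X - 1) * (C (jacobiCoeff n a b j * j) * ((X - 1) ^ (n - j) * (X + 1) ^ j)) := by
    intro j _
    rw [derivative_C_mul]
    have := mul_derivative_basis (n - j) j
    simp only [map_mul, map_natCast, pow_succ (X + 1 : ℝ[X]) j]
    linear_combination C (jacobiCoeff n a b j) * this
  rw [Finset.sum_congr rfl hL, Finset.sum_add_distrib, Finset.sum_range_succ,
    Nat.sub_self, Nat.cast_zero, mul_zero, map_zero, zero_mul, add_zero, add_assoc,
    ← Finset.sum_add_distrib, Finset.sum_range_succ', Finset.sum_range_succ' _ n, ← add_assoc,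
    ← Finset.sum_add_distrib]
  congr 1
  · refine Finset.sum_congr rfl fun j hj => ?_
    have hj' := Finset.mem_range.1 hj
    obtain ⟨i, rfl⟩ : ∃ i, n = j + 1 + i := ⟨n - (j + 1), by omega⟩
    have e1 : j + 1 + i - (j + 1) = i := by omega
    have e2 : j + 1 + i - j = i + 1 := by omega
    simp only [jacobiCoeff, e1, e2]
    have h1 := choose_succ_mul (((j + 1 + i : ℕ) : ℝ) + b) i
    have h2 := choose_mul_sub (((j + 1 + i : ℕ) : ℝ) + b) i
    have h3 := Ring.choose_succ_succ (((j + 1 + i : ℕ) : ℝ) + a) j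
    rw [show (((j + 1 + i : ℕ) : ℝ) + a) + 1 = ((j + 1 + i : ℕ) : ℝ) + (a + 1) by ring] at h3
    rw [show (((j + 1 + i : ℕ) : ℝ) + b) - 1 = ((j + 1 + i : ℕ) : ℝ) + (b - 1) by ring] at h2
    rw [h3]
    set N : ℝ := ((j + 1 + i : ℕ) : ℝ) with hN
    have hN' : N = j + 1 + i := by rw [hN]; push_cast; ring
    have hc : Ring.choose (N + a) j * Ring.choose (N + b) (i + 1) * ((i + 1 : ℕ) : ℝ) +
        (Ring.choose (N + a) (j + 1) * Ring.choose (N + b) i * ((j + 1 : ℕ) : ℝ) +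
        b * (Ring.choose (N + a) (j + 1) * Ring.choose (N + b) i)) =
        (N + b) * ((Ring.choose (N + a) j + Ring.choose (N + a) (j + 1)) *
          Ring.choose (N + (b - 1)) i) := by
      push_cast
      linear_combination Ring.choose (N + a) j * h1 +
        (Ring.choose (N + a) j + Ring.choose (N + a) (j + 1)) * h2 -
        Ring.choose (N + a) (j + 1) * Ring.choose (N + b) i * hN'
    have hC := congrArg (C : ℝ → ℝ[X]) hc
    simp only [map_add, map_mul] at hC ⊢
    rw [pow_succ (X - 1 : ℝ[X]) i]
    linear_combination (X - 1) * ((X - 1) ^ i * (X + 1) ^ (j + 1)) * hC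
  · have h2 := choose_mul_sub ((n : ℝ) + b) n
    have hC := congrArg (C : ℝ → ℝ[X]) h2
    simp only [jacobiCoeff, Nat.sub_zero, Ring.choose_zero_right, one_mul, Nat.cast_zero, mul_zero,
      map_zero, zero_mul, zero_add]
    rw [show (n : ℝ) + (b - 1) = n + b - 1 by ring]
    simp only [map_add, map_mul, map_sub] at hC ⊢
    linear_combination (X - 1) * (X - 1) ^ n * (X + 1) ^ 0 * hC

/-- Each basis product is monic of degree `n`, so the coefficients add up by Chu–Vandermonde. The
result is nonzero when `α + β` is not a negative integer. -/
theorem coeff_jacobi (n : ℕ) (α β : ℝ) :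
    (jacobi n α β).coeff n = (2 ^ n)⁻¹ * Ring.choose (2 * n + α + β) n := by
  have h (i j : ℕ) : ((X - 1) ^ i * (X + 1) ^ j : ℝ[X]).coeff (i + j) = 1 := by
    have hm : ((X - 1) ^ i * (X + 1) ^ j : ℝ[X]).Monic :=
      ((monic_X_sub_C 1).pow i).mul ((monic_X_add_C 1).pow j)
    have hd : ((X - 1) ^ i * (X + 1) ^ j : ℝ[X]).natDegree = i + j := by
      have := ((monic_X_sub_C (1 : ℝ)).pow i).natDegree_mul ((monic_X_add_C (1 : ℝ)).pow j)
      rw [(monic_X_sub_C (1 : ℝ)).natDegree_pow, (monic_X_add_C (1 : ℝ)).natDegree_pow,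
        natDegree_X_sub_C, natDegree_X_add_C, mul_one, mul_one] at this
      exact this
    rw [← hd]
    exact hm.coeff_natDegree
  rw [jacobi, coeff_C_mul, finsetSum_coeff, show (2 * n + α + β : ℝ) = (n + α) + (n + β) by ring,
    Ring.add_choose_eq n (Commute.all _ _), Finset.Nat.sum_antidiagonal_eq_sum_range_succ_mk]
  congr 1
  refine Finset.sum_congr rfl fun j hj => ?_
  have hj' : j ≤ n := Nat.lt_succ_iff.1 (Finset.mem_range.1 hj)
  rw [coeff_C_mul]
  have := h (n - j) j
  rw [Nat.sub_add_cancel hj'] at this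
  rw [this, mul_one]

theorem degree_jacobi (n : ℕ) {α β : ℝ} (h : ∀ m : ℕ, 1 ≤ m → α + β ≠ -m) :
    (jacobi n α β).degree = n := by
  refine degree_eq_of_le_of_coeff_ne_zero ?_ ?_
  · rw [degree_le_iff_coeff_zero]
    intro m hm
    refine coeff_eq_zero_of_natDegree_lt (lt_of_le_of_lt ?_ (Nat.cast_lt.1 hm))
    refine (natDegree_C_mul_le _ _).trans (natDegree_sum_le_of_forall_le _ _ fun j hj => ?_)
    refine (natDegree_C_mul_le _ _).trans ?_
    have hj' : j ≤ n := Nat.lt_succ_iff.1 (Finset.mem_range.1 hj)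
    refine natDegree_mul_le.trans ?_
    refine (add_le_add natDegree_pow_le natDegree_pow_le).trans ?_
    have e1 : (X - 1 : ℝ[X]).natDegree = 1 := natDegree_X_sub_C 1
    have e2 : (X + 1 : ℝ[X]).natDegree = 1 := natDegree_X_add_C 1
    rw [e1, e2]
    omega
  · rw [coeff_jacobi]
    refine mul_ne_zero (by positivity) (choose_ne_zero_of_forall fun i hi h0 => ?_)
    refine h (2 * n - i) (by omega) ?_
    rw [Nat.cast_sub (by omega)]
    push_cast
    linarith

theorem span_jacobi {α β : ℝ} (h : ∀ m : ℕ, 1 ≤ m → α + β ≠ -m) :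
    Submodule.span ℝ (Set.range fun n => jacobi n α β) = ⊤ :=
  Polynomial.Sequence.span ⟨fun n => jacobi n α β, fun n => degree_jacobi n h⟩ fun n =>
    (leadingCoeff_ne_zero.2 (Polynomial.Sequence.ne_zero
      ⟨fun n => jacobi n α β, fun n => degree_jacobi n h⟩ n)).isUnit

end Jacobi

/-! ### Exactness of the quotients by `(1 + x)^(k₂ (k₂ - 1))` -/

section Divisibility

/-- The polynomials `E_j h` with `(-1)^j (d/dx)^j ((1 + x)^(-β) h) = (1 + x)^(-β - j) E_j h`. -/
def twistedDeriv (β : ℝ) : ℕ → ℝ[X] →ₗ[ℝ] ℝ[X]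
  | 0 => LinearMap.id
  | j + 1 => (β + j) • twistedDeriv β j -
      (LinearMap.mulLeft ℝ (1 + X)).comp (derivative.comp (twistedDeriv β j))

theorem twistedDeriv_succ (β : ℝ) (j : ℕ) (h : ℝ[X]) :
    twistedDeriv β (j + 1) h =
      C (β + j) * twistedDeriv β j h - (1 + X) * derivative (twistedDeriv β j h) := by
  simp [twistedDeriv, smul_eq_C_mul]

theorem twistedDeriv_jacobi (α β : ℝ) (f j : ℕ) :
    twistedDeriv β j (jacobi f α (-β)) =
      C ((ascPochhammer ℝ j).eval (β - f)) * jacobi f (α + j) (-β - j) := by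
  induction j with
  | zero => simp [twistedDeriv]
  | succ j ih =>
    have h := jacobi_shift f (α + j) (-β - j)
    rw [twistedDeriv_succ, ih, derivative_C_mul, ascPochhammer_succ_eval,
      show α + ((j + 1 : ℕ) : ℝ) = α + j + 1 by push_cast; ring,
      show -β - ((j + 1 : ℕ) : ℝ) = -β - j - 1 by push_cast; ring]
    simp only [map_add, map_sub, map_mul, map_neg, map_natCast] at h ⊢
    linear_combination -C ((ascPochhammer ℝ j).eval (β - f)) * h

theorem entry₂_eq (α β : ℝ) (m f j : ℕ) :
    entry₂ α β m f j = (1 + X) ^ (m - j) * twistedDeriv β j (jacobi f α (-β)) := by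
  rw [entry₂, twistedDeriv_jacobi]
  ring

theorem mul_derivative_one_add_X_pow (d : ℕ) :
    (1 + X) * derivative ((1 + X) ^ d : ℝ[X]) = (d : ℝ[X]) * (1 + X) ^ d := by
  cases d with
  | zero => simp
  | succ d =>
    rw [derivative_pow_succ]
    simp only [derivative_one, derivative_X, Nat.cast_succ, map_add, map_one,
      map_natCast]
    ring

/-- `twistedDeriv` is built from the Euler operator `(1 + x) d/dx`, which is diagonal on powers of
`1 + x`. -/
theorem exists_twistedDeriv_pow (β : ℝ) (j d : ℕ) :
    ∃ c : ℝ, twistedDeriv β j ((1 + X) ^ d) = C c * (1 + X) ^ d := by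
  induction j with
  | zero => exact ⟨1, by simp [twistedDeriv]⟩
  | succ j ih =>
    obtain ⟨c, hc⟩ := ih
    refine ⟨(β + j - d) * c, ?_⟩
    have := mul_derivative_one_add_X_pow d
    rw [twistedDeriv_succ, hc, derivative_C_mul]
    simp only [map_add, map_sub, map_mul, map_natCast]
    linear_combination -C c * this

theorem sum_range_card_le_sum (s : Finset ℕ) : ∑ i ∈ Finset.range s.card, i ≤ ∑ i ∈ s, i := by
  induction s using Finset.induction_on_max with
  | empty => simp
  | insert a s hs ih =>
    have ha : a ∉ s := fun h => (hs a h).false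
    have hcard : s.card ≤ a := by
      simpa using Finset.card_le_card (fun x hx => Finset.mem_range.2 (hs x hx) :
        s ⊆ Finset.range a)
    rw [Finset.card_insert_of_notMem ha, Finset.sum_range_succ, Finset.sum_insert ha]
    omega

theorem mul_pred_le_sum_of_injective {K : ℕ} {x : Fin K → ℕ} (hx : Function.Injective x) :
    K * (K - 1) ≤ (∑ a, x a) * 2 := by
  have h := sum_range_card_le_sum (Finset.univ.image x)
  rw [Finset.card_image_of_injective _ hx, Finset.card_univ, Fintype.card_fin,
    Finset.sum_image fun _ _ _ _ h => hx h] at h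
  rw [← Finset.sum_range_id_mul_two]
  omega

theorem eq_sum_one_add_X_pow (q : ℝ[X]) {D : ℕ} (hD : q.natDegree < D) :
    q = ∑ d ∈ Finset.range D, C ((taylor (-1) q).coeff d) * (1 + X) ^ d := by
  conv_lhs => rw [← sum_taylor_eq q (-1)]
  rw [sum_over_range' _ _ D (by rwa [natDegree_taylor])]
  · refine Finset.sum_congr rfl fun d _ => ?_
    rw [map_neg, map_one, sub_neg_eq_add, add_comm]
  · simp

/-- If two exponents `d` coincide, two rows are equal. Otherwise, in each term of the Leibniz
expansion, the `d a` are `K` distinct naturals, and so are the exponents `n - 1 - j` of the columns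
used. Each family sums to at least `K (K - 1) / 2`. -/
theorem one_add_X_pow_dvd_det_of_pow {n K : ℕ} (β : ℝ) (B : Matrix (Fin n) (Fin n) ℝ[X])
    {ι : Fin K → Fin n} (hι : Function.Injective ι) (d : Fin K → ℕ)
    (hB : ∀ i j, B (ι i) j = (1 + X) ^ (n - 1 - j) * twistedDeriv β j ((1 + X) ^ d i)) :
    (1 + X) ^ (K * (K - 1)) ∣ B.det := by
  by_cases hd : Function.Injective d
  · rw [← Matrix.det_transpose, Matrix.det_apply]
    refine Finset.dvd_sum fun s _ => ?_
    rw [Units.smul_def, zsmul_eq_mul]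
    refine Dvd.dvd.mul_left ?_ _
    refine dvd_trans ?_ (Finset.prod_dvd_prod_of_subset (Finset.univ.image ι) Finset.univ _
      (Finset.subset_univ _))
    rw [Finset.prod_image fun _ _ _ _ h => hι h]
    refine dvd_trans ?_ (Finset.prod_dvd_prod_of_dvd
      (fun a => (1 + X : ℝ[X]) ^ ((n - 1 - s (ι a)) + d a)) _ fun a _ => ?_)
    · rw [Finset.prod_pow_eq_pow_sum, Finset.sum_add_distrib]
      refine pow_dvd_pow _ ?_
      have h1 := mul_pred_le_sum_of_injective hd
      have h2 := mul_pred_le_sum_of_injective (x := fun a => n - 1 - (s (ι a) : ℕ))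
        fun a b hab => hι (s.injective (Fin.ext (by
          have := (s (ι a)).2
          have := (s (ι b)).2
          simp only at hab
          omega)))
      omega
    · rw [Matrix.transpose_apply, hB]
      obtain ⟨c, hc⟩ := exists_twistedDeriv_pow β (s (ι a)) (d a)
      rw [hc]
      exact ⟨C c, by ring⟩
  · obtain ⟨a, b, hab, hne⟩ : ∃ a b, d a = d b ∧ a ≠ b := by
      simpa [Function.Injective] using hd
    rw [Matrix.det_zero_of_row_eq (hι.ne hne) (by funext j; rw [hB, hB, hab])]
    exact dvd_zero _

theorem one_add_X_pow_dvd_det {n K : ℕ} (β : ℝ) (B : Matrix (Fin n) (Fin n) ℝ[X])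
    {ι : Fin K → Fin n} (hι : Function.Injective ι) (q : Fin K → ℝ[X])
    (hB : ∀ i j, B (ι i) j = (1 + X) ^ (n - 1 - j) * twistedDeriv β j (q i)) :
    (1 + X) ^ (K * (K - 1)) ∣ B.det := by
  classical
  obtain ⟨D, hD⟩ : ∃ D, ∀ i, (q i).natDegree < D :=
    ⟨Finset.univ.sup (fun i => (q i).natDegree) + 1, fun i =>
      Nat.lt_succ_of_le (Finset.le_sup (f := fun i => (q i).natDegree) (Finset.mem_univ i))⟩
  -- Rows outside the range of `ι` get a single dummy index, so that multilinearity can expand all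
  -- rows uniformly.
  set A : Fin n → Finset ℕ := fun r => if r ∈ Set.range ι then Finset.range D else {0} with hA
  set v : Fin n → ℕ → ℝ[X] := fun r d => if r ∈ Set.range ι then
    C ((taylor (-1) (Function.extend ι q 0 r)).coeff d) else 1 with hv
  set N : Fin n → ℕ → Fin n → ℝ[X] := fun r d j => if r ∈ Set.range ι then
    (1 + X) ^ (n - 1 - j) * twistedDeriv β j ((1 + X) ^ d) else B r j with hN
  have hBsum : B = fun r => ∑ d ∈ A r, fun j => v r d * N r d j := by
    funext r j
    rw [Finset.sum_apply]
    by_cases hr : r ∈ Set.range ι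
    · simp only [hA, hv, hN, if_pos hr]
      obtain ⟨i, rfl⟩ := hr
      rw [hι.extend_apply, hB]
      conv_lhs => rw [eq_sum_one_add_X_pow (q i) (hD i)]
      simp only [map_sum, Finset.mul_sum, ← smul_eq_C_mul, map_smul]
      refine Finset.sum_congr rfl fun d _ => ?_
      rw [smul_eq_C_mul, smul_eq_C_mul]
      ring
    · simp only [hA, hv, hN, if_neg hr, Finset.sum_singleton, one_mul]
  have hdet : B.det = ∑ r ∈ Fintype.piFinset A,
      (Matrix.of fun i j => v i (r i) * N i (r i) j).det := by
    have := (Matrix.detRowAlternating (n := Fin n) (R := ℝ[X])).toMultilinearMap.map_sum_finset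
      (fun r d j => v r d * N r d j) A
    conv_lhs => rw [hBsum]
    exact this
  rw [hdet]
  refine Finset.dvd_sum fun r _ => ?_
  have h1 := Matrix.det_mul_column (fun i => v i (r i)) (Matrix.of fun i j => N i (r i) j)
  simp only [Matrix.of_apply] at h1
  rw [h1]
  refine Dvd.dvd.mul_left (one_add_X_pow_dvd_det_of_pow β _ hι (fun i => r (ι i)) ?_) _
  intro i j
  simp [hN]

theorem one_add_X_pow_dvd_det_omegaMatrix (α β : ℝ) (F₁ F₂ : Finset ℕ) :
    (1 + X) ^ (F₂.card * (F₂.card - 1)) ∣ (omegaMatrix α β F₁ F₂).det := by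
  refine one_add_X_pow_dvd_det β _ (ι := Fin.natAdd F₁.card) (fun a b h => by simpa using h)
    (fun i => jacobi (F₂.orderEmbOfFin rfl i) α (-β)) fun i j => ?_
  rw [← entry₂_eq]
  simp [omegaMatrix]

/-- The matrix whose determinant defines the exceptional polynomials, for an arbitrary polynomial
in its first row. -/
def opMatrix (α β : ℝ) (F₁ F₂ : Finset ℕ) (p : ℝ[X]) :
    Matrix (Fin (F₁.card + F₂.card + 1)) (Fin (F₁.card + F₂.card + 1)) ℝ[X] :=
  Matrix.of (Fin.cons
    (fun j => (-1) ^ (j : ℕ) * derivative^[j] p)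
    (Fin.append
      (fun i j => entry₁ α β (F₁.orderEmbOfFin rfl i) j)
      (fun i j => entry₂ α β (F₁.card + F₂.card) (F₂.orderEmbOfFin rfl i) j)))

theorem one_add_X_pow_dvd_det_opMatrix (α β : ℝ) (F₁ F₂ : Finset ℕ) (p : ℝ[X]) :
    (1 + X) ^ (F₂.card * (F₂.card - 1)) ∣ (opMatrix α β F₁ F₂ p).det := by
  refine one_add_X_pow_dvd_det β _ (ι := fun i => (Fin.natAdd F₁.card i).succ)
    (fun a b h => by simpa using h)
    (fun i => jacobi (F₂.orderEmbOfFin rfl i) α (-β)) fun i j => ?_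
  rw [← entry₂_eq]
  simp [opMatrix]

end Divisibility

/-! ### Power series in which `(1 + x)^r` exists for real `r` -/

section Series

/-- The derivation `-d/dx` of the ring of power series. -/
def negDeriv : Derivation ℝ (PowerSeries ℝ) (PowerSeries ℝ) := -PowerSeries.derivative ℝ

theorem negDeriv_coe (p : ℝ[X]) : negDeriv (p : PowerSeries ℝ) = (-derivative p : ℝ[X]) := by
  simp [negDeriv, PowerSeries.derivative_coe]

theorem negDeriv_C (c : ℝ) : negDeriv (PowerSeries.C c) = 0 := by
  simp [negDeriv]

theorem iterate_negDeriv_coe (p : ℝ[X]) (j : ℕ) :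
    negDeriv^[j] (p : PowerSeries ℝ) = ((-1) ^ j * derivative^[j] p : ℝ[X]) := by
  induction j with
  | zero => simp
  | succ j ih =>
    rw [Function.iterate_succ_apply', ih, negDeriv_coe, Function.iterate_succ_apply']
    congr 1
    have : derivative ((-1) ^ j * derivative^[j] p) = (-1) ^ j * derivative (derivative^[j] p) := by
      have h : ((-1) ^ j : ℝ[X]) = C ((-1) ^ j) := by simp
      rw [h, derivative_C_mul]
    rw [this]
    ring

/-- The power series of `(1 + x)^r`. -/
def binom (r : ℝ) : PowerSeries ℝ := PowerSeries.binomialSeries ℝ r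

theorem binom_mul_binom_neg (r : ℝ) : binom r * binom (-r) = 1 := by
  rw [binom, binom, ← PowerSeries.binomialSeries_add, add_neg_cancel,
    PowerSeries.binomialSeries_zero]

theorem mul_negDeriv_binom (r : ℝ) :
    ((1 + X : ℝ[X]) : PowerSeries ℝ) * negDeriv (binom r) = -(PowerSeries.C r * binom r) := by
  rw [negDeriv, Derivation.neg_apply, mul_neg, neg_inj]
  ext n
  rw [Polynomial.coe_add, Polynomial.coe_one, Polynomial.coe_X, add_mul, one_mul, map_add,
    PowerSeries.coeff_C_mul, PowerSeries.coeff_derivative]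
  simp only [binom, PowerSeries.binomialSeries_coeff, smul_eq_mul, mul_one]
  rw [choose_succ_mul]
  cases n with
  | zero => simp
  | succ n =>
    rw [PowerSeries.coeff_succ_X_mul, PowerSeries.coeff_derivative]
    simp only [PowerSeries.binomialSeries_coeff, smul_eq_mul, mul_one]
    push_cast
    ring

theorem mul_negDeriv_coe_pow (j : ℕ) : ((1 + X : ℝ[X]) : PowerSeries ℝ) *
    negDeriv (((1 + X : ℝ[X]) : PowerSeries ℝ) ^ j) =
      -(j * ((1 + X : ℝ[X]) : PowerSeries ℝ) ^ j) := by
  have h := congrArg (fun p : ℝ[X] => (p : PowerSeries ℝ)) (mul_derivative_one_add_X_pow j)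
  simp only [Polynomial.coe_mul, Polynomial.coe_pow] at h
  rw [← Polynomial.coe_pow, negDeriv_coe, Polynomial.coe_neg, mul_neg, h]
  have h2 : (((j : ℝ[X])) : PowerSeries ℝ) = (j : PowerSeries ℝ) :=
    map_natCast (Polynomial.coeToPowerSeries.ringHom (R := ℝ)) j
  rw [h2, Polynomial.coe_pow]

theorem coe_C_eq (c : ℝ) : ((C c : ℝ[X]) : PowerSeries ℝ) = PowerSeries.C c :=
  Polynomial.coe_C c

/-- The defining property of `twistedDeriv`, with the powers of `1 + x` cleared; it turns the `F₂`
rows into Wronskian rows. -/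
theorem pow_mul_iterate_negDeriv (β : ℝ) (h : ℝ[X]) (j : ℕ) :
    ((1 + X : ℝ[X]) : PowerSeries ℝ) ^ j * negDeriv^[j] (binom (-β) * (h : PowerSeries ℝ)) =
      binom (-β) * (twistedDeriv β j h : ℝ[X]) := by
  induction j with
  | zero => simp [twistedDeriv]
  | succ j ih =>
    have h1 := congrArg negDeriv ih
    have h2 := mul_negDeriv_coe_pow j
    have h3 := mul_negDeriv_binom (-β)
    rw [Function.iterate_succ_apply', twistedDeriv_succ]
    set u := negDeriv^[j] (binom (-β) * (h : PowerSeries ℝ))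
    set e := twistedDeriv β j h
    simp only [Derivation.leibniz, smul_eq_mul, negDeriv_coe, Polynomial.coe_neg] at h1
    simp only [Polynomial.coe_sub, Polynomial.coe_mul, coe_C_eq] at h1 h3 ⊢
    simp only [map_add, map_natCast, map_neg] at h1 h3 ⊢
    linear_combination ((1 + X : ℝ[X]) : PowerSeries ℝ) * h1 - u * h2 + (e : PowerSeries ℝ) * h3 +
      (j : PowerSeries ℝ) * ih

end Series

/-! ### The determinants as Wronskians of seed functions -/

section SeedFunctions

variable (α β : ℝ) (F₁ F₂ : Finset ℕ)

/-- The functions `P_f^{α,β}`, `f ∈ F₁`, and `(1 + x)^(-β) P_f^{α,-β}`, `f ∈ F₂`, as power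
series. -/
def seed : Fin (F₁.card + F₂.card) → PowerSeries ℝ :=
  Fin.append (fun i => (jacobi (F₁.orderEmbOfFin rfl i) α β : PowerSeries ℝ))
    (fun i => binom (-β) * (jacobi (F₂.orderEmbOfFin rfl i) α (-β) : PowerSeries ℝ))

/-- The factors between the rows of the Wronskian matrix of the seed functions and the rows of the
polynomial matrices. -/
def rowFactor (m : ℕ) : Fin (F₁.card + F₂.card) → PowerSeries ℝ :=
  Fin.append (fun _ => 1) (fun _ => ((1 + X : ℝ[X]) : PowerSeries ℝ) ^ m * binom β)

/-- The eigenvalues of the seed functions. -/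
def seedEigenvalue : Fin (F₁.card + F₂.card) → ℝ :=
  Fin.append
    (fun i => -((F₁.orderEmbOfFin rfl i : ℝ) * (F₁.orderEmbOfFin rfl i + α + β + 1)))
    (fun i => -((F₂.orderEmbOfFin rfl i - β) * (F₂.orderEmbOfFin rfl i + α + 1)))

variable {α β F₁ F₂}

theorem coe_entry₁ (n j : ℕ) :
    (entry₁ α β n j : PowerSeries ℝ) = negDeriv^[j] (jacobi n α β : PowerSeries ℝ) := by
  rw [iterate_negDeriv_coe, entry₁]

theorem coe_entry₂ {m j : ℕ} (hj : j ≤ m) (f : ℕ) :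
    (entry₂ α β m f j : PowerSeries ℝ) = ((1 + X : ℝ[X]) : PowerSeries ℝ) ^ m * binom β *
      negDeriv^[j] (binom (-β) * (jacobi f α (-β) : PowerSeries ℝ)) := by
  obtain ⟨i, rfl⟩ : ∃ i, m = i + j := ⟨m - j, by omega⟩
  have h1 := pow_mul_iterate_negDeriv β (jacobi f α (-β)) j
  have h2 := binom_mul_binom_neg β
  rw [entry₂_eq, Nat.add_sub_cancel, Polynomial.coe_mul, Polynomial.coe_pow]
  linear_combination -((1 + X : ℝ[X]) : PowerSeries ℝ) ^ i * binom β * h1 -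
    ((1 + X : ℝ[X]) : PowerSeries ℝ) ^ i *
      (twistedDeriv β j (jacobi f α (-β)) : PowerSeries ℝ) * h2

theorem coe_append_entries {m j : ℕ} (hj : j ≤ m) (i : Fin (F₁.card + F₂.card)) :
    ((Fin.append (fun i j => entry₁ α β (F₁.orderEmbOfFin rfl i) j)
      (fun i j => entry₂ α β m (F₂.orderEmbOfFin rfl i) j) i j : ℝ[X]) : PowerSeries ℝ) =
      rowFactor β F₁ F₂ m i * negDeriv^[j] (seed α β F₁ F₂ i) := by
  refine Fin.addCases (fun i => ?_) (fun i => ?_) i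
  · simp only [Fin.append_left, rowFactor, seed, one_mul]
    exact coe_entry₁ _ _
  · simp only [Fin.append_right, rowFactor, seed]
    exact coe_entry₂ hj _

theorem coe_omegaMatrix_apply (i j : Fin (F₁.card + F₂.card)) :
    (omegaMatrix α β F₁ F₂ i j : PowerSeries ℝ) =
      rowFactor β F₁ F₂ (F₁.card + F₂.card - 1) i * jetMatrix negDeriv (seed α β F₁ F₂) i j := by
  have hj : (j : ℕ) ≤ F₁.card + F₂.card - 1 := by omega
  rw [jetMatrix, Matrix.of_apply, ← coe_append_entries hj]
  refine Fin.addCases (fun i => ?_) (fun i => ?_) i <;> simp [omegaMatrix]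

theorem coe_det {n : ℕ} (M : Matrix (Fin n) (Fin n) ℝ[X]) :
    (M.det : PowerSeries ℝ) = (Matrix.of fun i j => (M i j : PowerSeries ℝ)).det :=
  (Polynomial.coeToPowerSeries.ringHom (R := ℝ)).map_det M

theorem coe_det_omegaMatrix :
    ((omegaMatrix α β F₁ F₂).det : PowerSeries ℝ) =
      (∏ i, rowFactor β F₁ F₂ (F₁.card + F₂.card - 1) i) *
        (jetMatrix negDeriv (seed α β F₁ F₂)).det := by
  rw [coe_det, ← Matrix.det_mul_column]
  simp only [coe_omegaMatrix_apply]

theorem coe_det_opMatrix (p : ℝ[X]) :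
    ((opMatrix α β F₁ F₂ p).det : PowerSeries ℝ) =
      (∏ i, rowFactor β F₁ F₂ (F₁.card + F₂.card) i) *
        (jetMatrix negDeriv (Fin.cons (p : PowerSeries ℝ) (seed α β F₁ F₂) :
          Fin (F₁.card + F₂.card + 1) → PowerSeries ℝ)).det := by
  have h := Matrix.det_mul_column
    (Fin.cons 1 (rowFactor β F₁ F₂ (F₁.card + F₂.card)) : Fin (F₁.card + F₂.card + 1) → _)
    (jetMatrix negDeriv (Fin.cons (p : PowerSeries ℝ) (seed α β F₁ F₂) :
          Fin (F₁.card + F₂.card + 1) → PowerSeries ℝ))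
  rw [Fin.prod_univ_succ] at h
  simp only [Fin.cons_zero, Fin.cons_succ, one_mul] at h
  rw [← h, coe_det]
  congr 1
  ext i j : 2
  refine Fin.cases ?_ (fun i => ?_) i
  · simp only [Matrix.of_apply, opMatrix, Fin.cons_zero, jetMatrix, one_mul, iterate_negDeriv_coe]
  · simp only [Matrix.of_apply, opMatrix, Fin.cons_succ, jetMatrix]
    rw [← coe_append_entries (by omega)]
    refine Fin.addCases (fun i => ?_) (fun i => ?_) i <;> simp

theorem prod_rowFactor (m : ℕ) : ∏ i, rowFactor β F₁ F₂ m i =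
    (((1 + X : ℝ[X]) : PowerSeries ℝ) ^ m * binom β) ^ F₂.card := by
  simp [Fin.prod_univ_add, rowFactor]

/-- The larger matrix has one more column, hence one more factor `1 + X` in each `F₂` row: this is
the power `F₂.card`. -/
theorem det_opMatrix_eq (hk : 0 < F₁.card + F₂.card)
    (hW : IsUnit (jetMatrix negDeriv (seed α β F₁ F₂)).det) (p : ℝ[X]) :
    ((opMatrix α β F₁ F₂ p).det : PowerSeries ℝ) =
      (-1) ^ (F₁.card + F₂.card) * ((1 + X : ℝ[X]) : PowerSeries ℝ) ^ F₂.card *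
        ((omegaMatrix α β F₁ F₂).det : PowerSeries ℝ) *
          monicOp negDeriv (seed α β F₁ F₂) (p : PowerSeries ℝ) := by
  obtain ⟨m, hm⟩ : ∃ m, F₁.card + F₂.card = m + 1 := ⟨F₁.card + F₂.card - 1, by omega⟩
  have hp : ((1 + X : ℝ[X]) : PowerSeries ℝ) ^ (F₁.card + F₂.card) =
      ((1 + X : ℝ[X]) : PowerSeries ℝ) ^ m * ((1 + X : ℝ[X]) : PowerSeries ℝ) := by
    rw [hm, pow_succ]
  rw [coe_det_opMatrix, det_jetMatrix_cons hW, coe_det_omegaMatrix, prod_rowFactor, prod_rowFactor,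
    show F₁.card + F₂.card - 1 = m by omega, hp]
  ring

theorem isUnit_coe_of_eval_zero_ne {p : ℝ[X]} (h : p.eval 0 ≠ 0) :
    IsUnit (p : PowerSeries ℝ) := by
  rw [PowerSeries.isUnit_iff_constantCoeff, Polynomial.constantCoeff_coe, isUnit_iff_ne_zero]
  rwa [← coeff_zero_eq_eval_zero] at h

theorem isUnit_one_add_X : IsUnit ((1 + X : ℝ[X]) : PowerSeries ℝ) :=
  isUnit_coe_of_eval_zero_ne (by simp)

theorem omega_mul_pow : omega α β F₁ F₂ * (1 + X) ^ (F₂.card * (F₂.card - 1)) =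
    (omegaMatrix α β F₁ F₂).det := by
  rw [omega, mul_comm]
  exact EuclideanDomain.mul_div_cancel'
    (pow_ne_zero _ (by rw [add_comm]; exact X_add_C_ne_zero 1))
    (one_add_X_pow_dvd_det_omegaMatrix α β F₁ F₂)

theorem opMatrix_div_mul_pow (p : ℝ[X]) :
    (opMatrix α β F₁ F₂ p).det / (1 + X) ^ (F₂.card * (F₂.card - 1)) *
      (1 + X) ^ (F₂.card * (F₂.card - 1)) = (opMatrix α β F₁ F₂ p).det := by
  rw [mul_comm]
  exact EuclideanDomain.mul_div_cancel'
    (pow_ne_zero _ (by rw [add_comm]; exact X_add_C_ne_zero 1))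
    (one_add_X_pow_dvd_det_opMatrix α β F₁ F₂ p)

theorem isUnit_wronskian (hΩ : (omega α β F₁ F₂).eval 0 ≠ 0) :
    IsUnit (jetMatrix negDeriv (seed α β F₁ F₂)).det := by
  have h : IsUnit ((omegaMatrix α β F₁ F₂).det : PowerSeries ℝ) :=
    isUnit_coe_of_eval_zero_ne (by rw [← omega_mul_pow]; simpa using hΩ)
  rw [coe_det_omegaMatrix] at h
  exact isUnit_of_mul_isUnit_right h

/-- The exceptional polynomial in terms of the monic operator. -/
theorem coe_opMatrix_div (hk : 0 < F₁.card + F₂.card) (hΩ : (omega α β F₁ F₂).eval 0 ≠ 0)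
    (p : ℝ[X]) :
    (((opMatrix α β F₁ F₂ p).det / (1 + X) ^ (F₂.card * (F₂.card - 1)) : ℝ[X]) :
      PowerSeries ℝ) =
      (-1) ^ (F₁.card + F₂.card) * ((1 + X : ℝ[X]) : PowerSeries ℝ) ^ F₂.card *
        (omega α β F₁ F₂ : PowerSeries ℝ) *
          monicOp negDeriv (seed α β F₁ F₂) (p : PowerSeries ℝ) := by
  refine (isUnit_one_add_X.pow (F₂.card * (F₂.card - 1))).mul_right_cancel ?_
  have h1 := congrArg (fun q : ℝ[X] => (q : PowerSeries ℝ))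
    (opMatrix_div_mul_pow (α := α) (β := β) (F₁ := F₁) (F₂ := F₂) p)
  have h2 := congrArg (fun q : ℝ[X] => (q : PowerSeries ℝ))
    (omega_mul_pow (α := α) (β := β) (F₁ := F₁) (F₂ := F₂))
  simp only [Polynomial.coe_mul, Polynomial.coe_pow] at h1 h2
  rw [h1, det_opMatrix_eq hk (isUnit_wronskian hΩ), ← h2]
  ring

/-- The leading coefficient of the Jacobi operator. -/
def jacobiσ : PowerSeries ℝ := ((1 - X ^ 2 : ℝ[X]) : PowerSeries ℝ)

/-- The first order coefficient of the Jacobi operator, for the derivation `-d/dx`. -/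
def jacobiτ (α β : ℝ) : PowerSeries ℝ := -((C (β - α) - C (α + β + 2) * X : ℝ[X]) : PowerSeries ℝ)

theorem jacobi_eigen (n : ℕ) (α β : ℝ) :
    jacobiσ * negDeriv (negDeriv (jacobi n α β : PowerSeries ℝ)) +
      jacobiτ α β * negDeriv (jacobi n α β : PowerSeries ℝ) =
      PowerSeries.C (-(n * (n + α + β + 1))) * (jacobi n α β : PowerSeries ℝ) := by
  have h := congrArg (fun q : ℝ[X] => (q : PowerSeries ℝ)) (jacobi_ode n α β)
  simp only [Polynomial.coe_mul, Polynomial.coe_add, Polynomial.coe_neg, coe_C_eq] at h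
  rw [negDeriv_coe, negDeriv_coe, derivative_neg, neg_neg, jacobiσ, jacobiτ, Polynomial.coe_neg,
    map_neg, ← h]
  ring

/-- Conjugation by `(1 + x)^(-β)` carries the Jacobi operator for `(α, β)` to the one for `(α, -β)`
plus the constant `-β (α + 1)` in the eigenvalue's opposite, as `(n - β) (n + α + 1) = n (n + α - β
+ 1) - β (α + 1)`. -/
theorem binom_mul_jacobi_eigen (n : ℕ) (α β : ℝ) :
    jacobiσ * negDeriv (negDeriv (binom (-β) * (jacobi n α (-β) : PowerSeries ℝ))) +
      jacobiτ α β * negDeriv (binom (-β) * (jacobi n α (-β) : PowerSeries ℝ)) =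
      PowerSeries.C (-((n - β) * (n + α + 1))) *
        (binom (-β) * (jacobi n α (-β) : PowerSeries ℝ)) := by
  refine isUnit_one_add_X.mul_left_cancel ?_
  have h := jacobi_eigen n α (-β)
  have e1 := mul_negDeriv_binom (-β)
  have e2 := congrArg negDeriv e1
  have hX : negDeriv ((1 + X : ℝ[X]) : PowerSeries ℝ) = -1 := by
    rw [negDeriv_coe]; simp
  simp only [map_neg, Derivation.leibniz, smul_eq_mul, hX, negDeriv_C] at e2
  simp only [map_neg] at e1
  set g := binom (-β)
  set y := (jacobi n α (-β) : PowerSeries ℝ)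
  set t := ((1 + X : ℝ[X]) : PowerSeries ℝ) with ht
  have hXt : (X : ℝ[X]).toPowerSeries = t - 1 := by rw [ht]; simp
  have hσ : jacobiσ = t * (2 - t) := by
    rw [jacobiσ, Polynomial.coe_sub, Polynomial.coe_pow, hXt, Polynomial.coe_one]
    ring
  simp only [jacobiτ, hσ, Polynomial.coe_sub, Polynomial.coe_mul, coe_C_eq, hXt] at h ⊢
  simp only [Derivation.leibniz, smul_eq_mul, map_add, map_sub, map_mul, map_neg, map_natCast,
    map_one, map_ofNat] at h ⊢
  linear_combination g * t * h + (2 - t) * t * y * e2 + (2 - t) * y * e1 + (2 - t) * PowerSeries.C β * y * e1 +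
    2 * t * (2 - t) * negDeriv y * e1 +
    (-(PowerSeries.C β - PowerSeries.C α - (PowerSeries.C α + PowerSeries.C β + 2) * (t - 1))) * y *
      e1

end SeedFunctions

/-! ### The transform of Jacobi polynomials: nonvanishing and concomitant -/

section Transform

variable {α β : ℝ} {F₁ F₂ : Finset ℕ}

theorem seed_eigen (i : Fin (F₁.card + F₂.card)) :
    jacobiσ * negDeriv (negDeriv (seed α β F₁ F₂ i)) +
      jacobiτ α β * negDeriv (seed α β F₁ F₂ i) =
      PowerSeries.C (seedEigenvalue α β F₁ F₂ i) * seed α β F₁ F₂ i := by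
  refine Fin.addCases (fun i => ?_) (fun i => ?_) i
  · simp only [seed, seedEigenvalue, Fin.append_left]
    exact jacobi_eigen _ _ _
  · simp only [seed, seedEigenvalue, Fin.append_right]
    exact binom_mul_jacobi_eigen _ _ _

/-- The differences factor as `(n - f) (n + f + α + β + 1)` and `(n - f + β) (n + f + α + 1)`; the
parameter conditions exclude the zeros of these factors. -/
theorem seedEigenvalue_sub_ne_zero (hα : ∀ m : ℕ, 1 ≤ m → α ≠ -m)
    (hαβ : ∀ m : ℕ, 1 ≤ m → α + β ≠ -m)
    (hβ : ∀ h : F₂.Nonempty, ∀ m : ℕ, 1 ≤ m → β - (F₂.max' h : ℕ) - 1 ≠ -m)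
    {n : ℕ} (hn : n ∉ F₁) (i : Fin (F₁.card + F₂.card)) :
    seedEigenvalue α β F₁ F₂ i - -(n * (n + α + β + 1)) ≠ 0 := by
  refine Fin.addCases (fun i => ?_) (fun i => ?_) i
  · simp only [seedEigenvalue, Fin.append_left]
    set f := F₁.orderEmbOfFin rfl i with hf
    have hfn : f ≠ n := fun h => hn (h ▸ F₁.orderEmbOfFin_mem rfl i)
    have h1 : (n : ℝ) - f ≠ 0 := sub_ne_zero.2 (Nat.cast_injective.ne hfn.symm)
    have h2 : (n : ℝ) + f + α + β + 1 ≠ 0 := fun h =>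
      hαβ (n + f + 1) (by omega) (by push_cast; linarith)
    rw [show -((f : ℝ) * (f + α + β + 1)) - -(n * (n + α + β + 1)) =
      (n - f) * (n + f + α + β + 1) by ring]
    exact mul_ne_zero h1 h2
  · simp only [seedEigenvalue, Fin.append_right]
    set f := F₂.orderEmbOfFin rfl i with hf
    have hfm : f ∈ F₂ := F₂.orderEmbOfFin_mem rfl i
    have hle := F₂.le_max' f hfm
    have h1 : (n : ℝ) - f + β ≠ 0 := fun h => by
      -- For this `m`, the excluded equality is `β = f - n`.
      refine hβ ⟨f, hfm⟩ (F₂.max' ⟨f, hfm⟩ - f + n + 1) (by omega) ?_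
      push_cast [Nat.cast_sub hle]
      linarith
    have h2 : (n : ℝ) + f + α + 1 ≠ 0 := fun h =>
      hα (n + f + 1) (by omega) (by push_cast; linarith)
    rw [show -(((f : ℝ) - β) * (f + α + 1)) - -(n * (n + α + β + 1)) =
      (n - f + β) * (n + f + α + 1) by ring]
    exact mul_ne_zero h1 h2

/-- The polynomial transform that maps the Jacobi polynomials to the exceptional polynomials. -/
def transform (α β : ℝ) (F₁ F₂ : Finset ℕ) (p : ℝ[X]) : ℝ[X] :=
  (opMatrix α β F₁ F₂ p).det / (1 + X) ^ (F₂.card * (F₂.card - 1))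

theorem excJacobi_eq_transform (n : ℕ) :
    excJacobi α β F₁ F₂ n = transform α β F₁ F₂ (jacobi (n - uF F₁ F₂) α β) := rfl

theorem coe_transform (hk : 0 < F₁.card + F₂.card) (hΩ : (omega α β F₁ F₂).eval 0 ≠ 0)
    (p : ℝ[X]) : (transform α β F₁ F₂ p : PowerSeries ℝ) =
      (-1) ^ (F₁.card + F₂.card) * ((1 + X : ℝ[X]) : PowerSeries ℝ) ^ F₂.card *
        (omega α β F₁ F₂ : PowerSeries ℝ) *
          monicOp negDeriv (seed α β F₁ F₂) (p : PowerSeries ℝ) :=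
  coe_opMatrix_div hk hΩ p

theorem isUnit_coe_transform_factor (hΩ : (omega α β F₁ F₂).eval 0 ≠ 0) :
    IsUnit ((-1) ^ (F₁.card + F₂.card) * ((1 + X : ℝ[X]) : PowerSeries ℝ) ^ F₂.card *
        (omega α β F₁ F₂ : PowerSeries ℝ)) :=
  ((isUnit_one.neg.pow _).mul (isUnit_one_add_X.pow _)).mul (isUnit_coe_of_eval_zero_ne hΩ)

theorem transform_jacobi_ne_zero (hk : 0 < F₁.card + F₂.card)
    (hΩ : (omega α β F₁ F₂).eval 0 ≠ 0) (hα : ∀ m : ℕ, 1 ≤ m → α ≠ -m)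
    (hαβ : ∀ m : ℕ, 1 ≤ m → α + β ≠ -m)
    (hβ : ∀ h : F₂.Nonempty, ∀ m : ℕ, 1 ≤ m → β - (F₂.max' h : ℕ) - 1 ≠ -m)
    {n : ℕ} (hn : n ∉ F₁) : transform α β F₁ F₂ (jacobi n α β) ≠ 0 := by
  intro h0
  have h := coe_transform hk hΩ (jacobi n α β)
  rw [h0, Polynomial.coe_zero] at h
  have h1 := (isUnit_coe_transform_factor hΩ).mul_right_eq_zero.1 h.symm
  have h2 := eq_zero_of_monicOp_eq_zero (isUnit_wronskian hΩ)
    (fun i => negDeriv_C (seedEigenvalue α β F₁ F₂ i)) seed_eigen (negDeriv_C _)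
    (jacobi_eigen n α β) (fun i => by
      rw [← map_sub]
      exact (isUnit_iff_ne_zero.2 (seedEigenvalue_sub_ne_zero hα hαβ hβ hn i)).map _) h1
  rw [Polynomial.coe_eq_zero_iff] at h2
  have h3 := degree_jacobi n hαβ
  rw [h2] at h3
  simp at h3

/-- This is `concomitant_monicOp` rewritten for `y` and `z`. The common factor `(1 + x)^(k₂) Ω`
enters `W` squared, so the sign `(-1)^k` disappears, and its logarithmic derivative yields the terms
in `F₂.card` and `derivative Ω`. -/
theorem transform_concomitant (hk : 0 < F₁.card + F₂.card)
    (hΩ : (omega α β F₁ F₂).eval 0 ≠ 0) (n m : ℕ) {y z W : ℝ[X]}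
    (hy : y = transform α β F₁ F₂ (jacobi n α β)) (hz : z = transform α β F₁ F₂ (jacobi m α β))
    (hWr : W = y * derivative z - z * derivative y) :
    (1 - X ^ 2) * (omega α β F₁ F₂ * derivative W - 2 * derivative (omega α β F₁ F₂) * W) +
      (C (β - α - 2 * F₂.card) - C (α + β + 2 + 2 * F₁.card) * X) * (omega α β F₁ F₂ * W) =
      C (n * (n + α + β + 1) - m * (m + α + β + 1)) * (omega α β F₁ F₂ * (y * z)) := by
  rw [← Polynomial.coe_inj]
  refine (isUnit_one_add_X.pow F₂.card).mul_right_cancel ?_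
  have hc := concomitant_monicOp (isUnit_wronskian hΩ)
    (fun i => negDeriv_C (seedEigenvalue α β F₁ F₂ i)) seed_eigen (negDeriv_C _) (negDeriv_C _)
    (jacobi_eigen n α β) (jacobi_eigen m α β)
  have ey := coe_transform hk hΩ (jacobi n α β)
  have ez := coe_transform hk hΩ (jacobi m α β)
  rw [← hy] at ey
  rw [← hz] at ez
  have ht := mul_negDeriv_coe_pow F₂.card
  set N := omega α β F₁ F₂
  set a := monicOp negDeriv (seed α β F₁ F₂) (jacobi n α β : PowerSeries ℝ)
  set b := monicOp negDeriv (seed α β F₁ F₂) (jacobi m α β : PowerSeries ℝ)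
  set T := ((1 + X : ℝ[X]) : PowerSeries ℝ) ^ F₂.card with hT
  set ε : PowerSeries ℝ := (-1) ^ (F₁.card + F₂.card) with hε
  have hε2 : ε * ε = 1 := by rw [hε, ← mul_pow]; simp
  have hεd : negDeriv ε = 0 := by
    have : ε = PowerSeries.C ((-1) ^ (F₁.card + F₂.card)) := by simp [hε]
    rw [this, negDeriv_C]
  have hW : (W : PowerSeries ℝ) =
      -(T * N * (T * N) * (a * negDeriv b - b * negDeriv a)) := by
    have e1 : (W : PowerSeries ℝ) = -((y : PowerSeries ℝ) * negDeriv (z : PowerSeries ℝ) -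
        (z : PowerSeries ℝ) * negDeriv (y : PowerSeries ℝ)) := by
      rw [hWr, negDeriv_coe, negDeriv_coe]
      simp only [Polynomial.coe_sub, Polynomial.coe_mul, Polynomial.coe_neg]
      ring
    rw [e1, ey, ez]
    simp only [Derivation.leibniz, smul_eq_mul, hεd]
    linear_combination -(T * N * (T * N) * (a * negDeriv b - b * negDeriv a)) * hε2
  have hdW := congrArg negDeriv hW
  have hyz : (y : PowerSeries ℝ) * (z : PowerSeries ℝ) = T * N * (T * N) * (a * b) := by
    rw [ey, ez]
    linear_combination (T * N * (T * N) * (a * b)) * hε2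
  have hdσ : negDeriv jacobiσ = ((2 * X : ℝ[X]) : PowerSeries ℝ) := by
    rw [jacobiσ, negDeriv_coe]
    congr 1
    simp
    norm_num
  rw [negDeriv_coe] at hdW
  have hdN : negDeriv (N : PowerSeries ℝ) = -(derivative N : ℝ[X]).toPowerSeries := by
    rw [negDeriv_coe, Polynomial.coe_neg]
  rw [hdσ] at hc
  set w := a * negDeriv b - b * negDeriv a with hw
  simp only [map_neg, Derivation.leibniz, smul_eq_mul, hdN, Polynomial.coe_neg] at hdW
  have h2 : ((2 : ℝ[X]) : PowerSeries ℝ) = 2 :=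
    map_ofNat (Polynomial.coeToPowerSeries.ringHom (R := ℝ)) 2
  have hadd : ((1 + X : ℝ[X]) : PowerSeries ℝ) = 1 + (X : ℝ[X]).toPowerSeries := by simp
  simp only [Polynomial.coe_add, Polynomial.coe_sub, Polynomial.coe_mul, Polynomial.coe_pow,
    Polynomial.coe_one, coe_C_eq, jacobiσ, jacobiτ, h2, hyz, hadd] at hc ht ⊢
  simp only [map_add, map_sub, map_mul, map_neg, map_natCast, map_one, map_ofNat,
    Nat.cast_add] at hc ⊢
  set x := (X : ℝ[X]).toPowerSeries
  set Nd := (derivative N : ℝ[X]).toPowerSeries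
  set Ns := (N : ℝ[X]).toPowerSeries
  set cα := PowerSeries.C α
  set cβ := PowerSeries.C β
  rw [hW]
  linear_combination (-(1 - x ^ 2) * Ns * T) * hdW + (T * Ns) ^ 3 * hc +
    (2 * (1 - x) * w * T ^ 2 * Ns ^ 3) * ht

/-! ### The range of the transform contains an ideal -/

theorem submodule_eq_top_of_one_add_X_pow_mem {S : Submodule ℝ ℝ[X]}
    (h : ∀ n : ℕ, (1 + X : ℝ[X]) ^ n ∈ S) : S = ⊤ := by
  refine eq_top_iff.2 fun q _ => ?_
  rw [eq_sum_one_add_X_pow q q.natDegree.lt_succ_self]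
  refine S.sum_mem fun n _ => ?_
  rw [← smul_eq_C_mul]
  exact S.smul_mem _ (h n)

theorem exists_derivative_eq (q : ℝ[X]) : ∃ p, derivative p = q := by
  have h : LinearMap.range (derivative (R := ℝ)) = ⊤ :=
    submodule_eq_top_of_one_add_X_pow_mem fun n => ⟨C ((n + 1 : ℝ)⁻¹) * (1 + X) ^ (n + 1), by
      have hn : (n + 1 : ℝ) ≠ 0 := by positivity
      rw [derivative_C_mul, derivative_pow_succ]
      simp only [derivative_add, derivative_one, derivative_X, zero_add, mul_one]
      rw [← mul_assoc, ← C_mul, inv_mul_cancel₀ hn, C_1, one_mul]⟩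
  exact LinearMap.range_eq_top.1 h q

theorem exists_euler_eq {c : ℝ} (hc : ∀ n : ℕ, c + n ≠ 0) (q : ℝ[X]) :
    ∃ p, C c * p + (1 + X) * derivative p = q := by
  have h : LinearMap.range (c • LinearMap.id +
      (LinearMap.mulLeft ℝ (1 + X : ℝ[X])).comp derivative) = ⊤ :=
    submodule_eq_top_of_one_add_X_pow_mem fun n => ⟨C ((c + n)⁻¹) * (1 + X) ^ n, by
      have h1 := mul_derivative_one_add_X_pow n
      have h2 := congrArg (C : ℝ → ℝ[X]) (inv_mul_cancel₀ (hc n))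
      simp only [LinearMap.add_apply, LinearMap.smul_apply, LinearMap.id_apply,
        LinearMap.comp_apply, LinearMap.mulLeft_apply, derivative_C_mul, smul_eq_C_mul]
      simp only [map_mul, map_add, map_natCast, map_one] at h2
      linear_combination C ((c + n)⁻¹) * h1 + (1 + X) ^ n * h2⟩
  obtain ⟨p, hp⟩ := LinearMap.range_eq_top.1 h q
  refine ⟨p, ?_⟩
  rw [← hp]
  simp [smul_eq_C_mul]

/-- The integrals in the variation of parameters stay polynomial once multiplied by the seed. For
`F₂`, the ansatz `(1 + x)^(β + m + 1) p` leads to an Euler equation for `p`, solvable because `β + m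
+ 1 + n` is never zero. -/
theorem exists_negDeriv_eq (hβ : ∀ m : ℕ, 1 ≤ m → β ≠ -m) (m : ℕ) (q : ℝ[X])
    (i : Fin (F₁.card + F₂.card)) :
    ∃ (h : PowerSeries ℝ) (p : ℝ[X]), negDeriv h = q * rowFactor β F₁ F₂ m i ∧
      h * seed α β F₁ F₂ i = p := by
  refine Fin.addCases (fun i => ?_) (fun i => ?_) i
  · simp only [rowFactor, seed, Fin.append_left]
    obtain ⟨p, hp⟩ := exists_derivative_eq (-q)
    refine ⟨p, p * jacobi (F₁.orderEmbOfFin rfl i) α β, ?_, (Polynomial.coe_mul _ _).symm⟩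
    rw [negDeriv_coe, hp, neg_neg, mul_one]
  · simp only [rowFactor, seed, Fin.append_right]
    obtain ⟨p, hp⟩ := exists_euler_eq (c := β + m + 1) (fun n h =>
      hβ (m + 1 + n) (by omega) (by push_cast; linarith)) (-q)
    refine ⟨((1 + X : ℝ[X]) : PowerSeries ℝ) ^ (m + 1) * binom β * p,
      (1 + X) ^ (m + 1) * p * jacobi (F₂.orderEmbOfFin rfl i) α (-β), ?_, ?_⟩
    · have h1 := congrArg (fun q : ℝ[X] => (q : PowerSeries ℝ)) hp
      have h2 := mul_negDeriv_coe_pow (m + 1)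
      have h3 := mul_negDeriv_binom β
      refine isUnit_one_add_X.mul_left_cancel ?_
      simp only [Derivation.leibniz, smul_eq_mul, negDeriv_coe]
      simp only [Polynomial.coe_add (C _ * p), Polynomial.coe_mul, coe_C_eq,
        Polynomial.coe_neg] at h1 ⊢
      simp only [map_add, map_natCast, map_one, Nat.cast_add, Nat.cast_one] at h1 h2
      linear_combination (binom β * p) * h2 +
        ((1 + X : ℝ[X]) : PowerSeries ℝ) ^ (m + 1) * p * h3 -
        ((1 + X : ℝ[X]) : PowerSeries ℝ) ^ (m + 1) * binom β * h1
    · have h := binom_mul_binom_neg β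
      simp only [Polynomial.coe_mul, Polynomial.coe_pow]
      linear_combination ((1 + X : ℝ[X]) : PowerSeries ℝ) ^ (m + 1) * p *
        (jacobi (F₂.orderEmbOfFin rfl i) α (-β) : PowerSeries ℝ) * h

/-- Variation of parameters asks for a solution of a linear system with only its last right-hand
side nonzero. The last row of the adjugate provides one without division, at the price of the factor
`det`. -/
theorem exists_monicOp_eq (hk : 0 < F₁.card + F₂.card) (hΩ : (omega α β F₁ F₂).eval 0 ≠ 0)
    (hβ : ∀ m : ℕ, 1 ≤ m → β ≠ -m) (r : ℝ[X]) :
    ∃ p : ℝ[X], monicOp negDeriv (seed α β F₁ F₂) (p : PowerSeries ℝ) =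
      ((omegaMatrix α β F₁ F₂).det * r : ℝ[X]) := by
  set B := omegaMatrix α β F₁ F₂ with hB
  set last : Fin (F₁.card + F₂.card) := ⟨F₁.card + F₂.card - 1, by omega⟩ with hlast
  choose h p hh hp using fun i => exists_negDeriv_eq (α := α) (F₁ := F₁) (F₂ := F₂) hβ
    (F₁.card + F₂.card - 1) (B.adjugate last i * r) i
  refine ⟨∑ i, p i, ?_⟩
  have hsum : ((∑ i, p i : ℝ[X]) : PowerSeries ℝ) = ∑ i, h i * seed α β F₁ F₂ i := by
    simp only [hp, ← Polynomial.coeToPowerSeries.ringHom_apply, map_sum]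
  rw [hsum]
  refine monicOp_sum_mul (isUnit_wronskian hΩ) (fun j => ?_) hk
  have e : ∀ i, negDeriv (h i) * negDeriv^[(j : ℕ)] (seed α β F₁ F₂ i) =
      (Polynomial.coeToPowerSeries.ringHom (R := ℝ)) (B.adjugate last i * B i j * r) := by
    intro i
    have := coe_omegaMatrix_apply (α := α) (β := β) (F₁ := F₁) (F₂ := F₂) i j
    rw [jetMatrix, Matrix.of_apply] at this
    rw [hh, Polynomial.coeToPowerSeries.ringHom_apply]
    simp only [Polynomial.coe_mul, hB, this]
    ring
  rw [Finset.sum_congr rfl fun i _ => e i, ← map_sum, ← Finset.sum_mul, ← Matrix.mul_apply,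
    Matrix.adjugate_mul, Matrix.smul_apply, Matrix.one_apply]
  by_cases hj : (j : ℕ) + 1 = F₁.card + F₂.card
  · rw [if_pos hj, if_pos (Fin.ext (by simp only [hlast]; omega)), smul_eq_mul, mul_one]
    rfl
  · rw [if_neg hj, if_neg fun h => hj (by rw [← h]; simp only [hlast]; omega), smul_zero, zero_mul,
      map_zero]

/-- The range of the transform contains a nonzero ideal. -/
theorem exists_transform_eq (hk : 0 < F₁.card + F₂.card) (hΩ : (omega α β F₁ F₂).eval 0 ≠ 0)
    (hβ : ∀ m : ℕ, 1 ≤ m → β ≠ -m) :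
    ∃ Q : ℝ[X], Q ≠ 0 ∧ ∀ r, ∃ p, transform α β F₁ F₂ p = Q * r := by
  have hΩ0 : omega α β F₁ F₂ ≠ 0 := fun h => hΩ (by rw [h, eval_zero])
  have ht0 : (1 + X : ℝ[X]) ≠ 0 := by rw [add_comm]; exact X_add_C_ne_zero 1
  refine ⟨(-1) ^ (F₁.card + F₂.card) * (1 + X) ^ F₂.card * omega α β F₁ F₂ *
    (omegaMatrix α β F₁ F₂).det, ?_, fun r => ?_⟩
  · rw [← omega_mul_pow]
    have h1 : ((-1) ^ (F₁.card + F₂.card) : ℝ[X]) ≠ 0 := pow_ne_zero _ (by simp)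
    exact mul_ne_zero (mul_ne_zero (mul_ne_zero h1 (pow_ne_zero _ ht0)) hΩ0)
      (mul_ne_zero hΩ0 (pow_ne_zero _ ht0))
  · obtain ⟨p, hp⟩ := exists_monicOp_eq hk hΩ hβ r
    refine ⟨p, ?_⟩
    rw [← Polynomial.coe_inj, coe_transform hk hΩ, hp]
    simp only [Polynomial.coe_mul, Polynomial.coe_pow, Polynomial.coe_neg, Polynomial.coe_one]
    ring

/-- The transform as a linear map. -/
theorem exists_linearMap_transform (hk : 0 < F₁.card + F₂.card)
    (hΩ : (omega α β F₁ F₂).eval 0 ≠ 0) :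
    ∃ L : ℝ[X] →ₗ[ℝ] ℝ[X], ∀ p, L p = transform α β F₁ F₂ p := by
  refine ⟨⟨⟨transform α β F₁ F₂, fun p q => ?_⟩, fun c p => ?_⟩, fun p => rfl⟩
  · rw [← Polynomial.coe_inj, Polynomial.coe_add]
    simp only [coe_transform hk hΩ, Polynomial.coe_add, monicOp_add]
    ring
  · rw [← Polynomial.coe_inj, RingHom.id_apply, smul_eq_C_mul, smul_eq_C_mul, Polynomial.coe_mul]
    simp only [coe_transform hk hΩ, Polynomial.coe_mul, coe_C_eq, monicOp_const_mul (negDeriv_C c)]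
    ring

theorem transform_jacobi_eq_zero (hk : 0 < F₁.card + F₂.card)
    (hΩ : (omega α β F₁ F₂).eval 0 ≠ 0) {f : ℕ} (hf : f ∈ F₁) :
    transform α β F₁ F₂ (jacobi f α β) = 0 := by
  obtain ⟨i, hi⟩ : f ∈ Set.range (F₁.orderEmbOfFin rfl) := by simpa using hf
  have h := monicOp_apply_self (isUnit_wronskian hΩ) (Fin.castAdd F₂.card i)
  rw [seed, Fin.append_left, hi, ← seed] at h
  rw [← Polynomial.coe_inj, coe_transform hk hΩ, h, mul_zero, Polynomial.coe_zero]

/-- The span of the exceptional polynomials contains a nonzero ideal. -/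
theorem exists_mul_mem_span (hk : 0 < F₁.card + F₂.card) (hΩ : (omega α β F₁ F₂).eval 0 ≠ 0)
    (hβ : ∀ m : ℕ, 1 ≤ m → β ≠ -m) (hαβ : ∀ m : ℕ, 1 ≤ m → α + β ≠ -m) :
    ∃ Q : ℝ[X], Q ≠ 0 ∧ ∀ r,
      Q * r ∈ Submodule.span ℝ (excJacobi α β F₁ F₂ '' sigmaF F₁ F₂) := by
  obtain ⟨Q, hQ, h⟩ := exists_transform_eq hk hΩ hβ
  obtain ⟨L, hL⟩ := exists_linearMap_transform hk hΩ
  refine ⟨Q, hQ, fun r => ?_⟩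
  obtain ⟨p, hp⟩ := h r
  rw [← hp, ← hL]
  have hmem : p ∈ Submodule.span ℝ (Set.range fun n => jacobi n α β) := by
    rw [span_jacobi hαβ]
    trivial
  have hle : Submodule.span ℝ (Set.range fun n => jacobi n α β) ≤
      (Submodule.span ℝ (excJacobi α β F₁ F₂ '' sigmaF F₁ F₂)).comap L := by
    refine Submodule.span_le.2 ?_
    rintro _ ⟨n, rfl⟩
    rw [SetLike.mem_coe, Submodule.mem_comap, hL]
    by_cases hn : n ∈ F₁
    · rw [transform_jacobi_eq_zero hk hΩ hn]
      exact zero_mem _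
    · refine Submodule.subset_span ⟨uF F₁ F₂ + n, ⟨by omega, fun f hf h => hn ?_⟩, ?_⟩
      · rwa [Nat.add_left_cancel h]
      · rw [excJacobi_eq_transform, Nat.add_sub_cancel_left]
  exact hle hmem

end Transform

/-! ### Density in `L²` of a space containing a polynomial ideal -/

section Density

variable {μ : Measure ℝ}

theorem memLp_eval [IsFiniteMeasure μ] (hμ : ∀ᵐ x ∂μ, x ∈ Set.Icc (-1 : ℝ) 1) (p : ℝ[X])
    (q : ENNReal) : MemLp (fun x => p.eval x) q μ := by
  obtain ⟨M, hM⟩ := isCompact_Icc.exists_bound_of_continuousOn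
    (p.continuous.continuousOn (s := Set.Icc (-1 : ℝ) 1))
  refine MemLp.of_bound p.continuous.aestronglyMeasurable M ?_
  filter_upwards [hμ] with x hx using hM x hx

theorem ae_eval_ne_zero (hμ : μ ≪ volume) {p : ℝ[X]} (hp : p ≠ 0) : ∀ᵐ x ∂μ, p.eval x ≠ 0 := by
  have h : {x : ℝ | p.eval x = 0}.Finite := by
    refine (p.roots.toFinset.finite_toSet).subset fun x hx => ?_
    simpa [hp] using hx
  have h0 : ∀ᵐ x, p.eval x ≠ 0 := by
    rw [ae_iff]
    simpa using h.measure_zero (volume : Measure ℝ)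
  exact hμ.ae_le h0

theorem integral_sq_pos_of_ne_zero [IsFiniteMeasure μ] (hμ : ∀ᵐ x ∂μ, x ∈ Set.Icc (-1 : ℝ) 1)
    (hac : μ ≪ volume) (hμ0 : μ ≠ 0) {p : ℝ[X]} (hp : p ≠ 0) : 0 < ∫ x, p.eval x ^ 2 ∂μ := by
  have hint : Integrable (fun x => p.eval x ^ 2) μ := by
    have := (memLp_eval hμ (p ^ 2) 1).integrable le_rfl
    simpa only [eval_pow] using this
  have hnn : 0 ≤ fun x => p.eval x ^ 2 := fun x => sq_nonneg (p.eval x)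
  refine lt_of_le_of_ne (integral_nonneg hnn) fun h0 => ?_
  have hz := (integral_eq_zero_iff_of_nonneg hnn hint).1 h0.symm
  have hfalse : ∀ᵐ x ∂μ, False := by
    filter_upwards [hz, ae_eval_ne_zero hac hp] with x h1 h2
    exact h2 (pow_eq_zero_iff two_ne_zero |>.1 h1)
  rw [Filter.eventually_false_iff_eq_bot, ae_eq_bot] at hfalse
  exact hμ0 hfalse

/-- The class in `L²` of a polynomial. -/
def polyLp [IsFiniteMeasure μ] (hμ : ∀ᵐ x ∂μ, x ∈ Set.Icc (-1 : ℝ) 1) :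
    ℝ[X] →ₗ[ℝ] Lp ℝ 2 μ where
  toFun p := (memLp_eval hμ p 2).toLp
  map_add' p q := by
    refine Lp.ext ?_
    filter_upwards [(memLp_eval hμ (p + q) 2).coeFn_toLp, (memLp_eval hμ p 2).coeFn_toLp,
      (memLp_eval hμ q 2).coeFn_toLp,
      Lp.coeFn_add (memLp_eval hμ p 2).toLp (memLp_eval hμ q 2).toLp] with x h1 h2 h3 h4
    rw [h1, h4, Pi.add_apply, h2, h3, eval_add]
  map_smul' c p := by
    refine Lp.ext ?_
    filter_upwards [(memLp_eval hμ (c • p) 2).coeFn_toLp, (memLp_eval hμ p 2).coeFn_toLp,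
      Lp.coeFn_smul c (memLp_eval hμ p 2).toLp] with x h1 h2 h3
    rw [h1, RingHom.id_apply, h3, Pi.smul_apply, h2, eval_smul]

theorem coeFn_polyLp [IsFiniteMeasure μ] (hμ : ∀ᵐ x ∂μ, x ∈ Set.Icc (-1 : ℝ) 1) (p : ℝ[X]) :
    polyLp hμ p =ᵐ[μ] fun x => p.eval x :=
  (memLp_eval hμ p 2).coeFn_toLp

/-- A function that is orthogonal to a nonzero ideal of the polynomials vanishes. -/
theorem ae_eq_zero_of_integral_ideal_eq_zero [IsFiniteMeasure μ]
    (hμ : ∀ᵐ x ∂μ, x ∈ Set.Icc (-1 : ℝ) 1) (hac : μ ≪ volume) {Q : ℝ[X]} (hQ : Q ≠ 0)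
    {g : ℝ → ℝ} (hg : MemLp g 2 μ) (h : ∀ r : ℝ[X], ∫ x, (Q * r).eval x * g x ∂μ = 0) :
    g =ᵐ[μ] 0 := by
  have hQg (r : ℝ[X]) : Integrable (fun x => (Q * r).eval x * g x) μ :=
    (memLp_eval hμ (Q * r) 2).integrable_mul hg
  have hQg1 : Integrable (fun x => Q.eval x * g x) μ := by simpa using hQg 1
  have key : ∀ᵐ x ∂μ, Q.eval x * g x = 0 := by
    refine ae_eq_zero_of_integral_contDiff_smul_eq_zero hQg1.locallyIntegrable fun f hf _ => ?_
    set I := ∫ x, |Q.eval x * g x| ∂μ with hI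
    have hI0 : 0 ≤ I := integral_nonneg fun x => abs_nonneg _
    have hbound : ∀ ε > 0, |∫ x, f x • (Q.eval x * g x) ∂μ| ≤ ε * I := by
      intro ε hε
      obtain ⟨p, hp⟩ := exists_polynomial_near_of_continuousOn (-1) 1 f hf.continuous.continuousOn
        ε hε
      have hsub : ∀ᵐ x ∂μ, ‖f x • (Q.eval x * g x) - (Q * p).eval x * g x‖ ≤
          ε * |Q.eval x * g x| := by
        filter_upwards [hμ] with x hx
        rw [eval_mul, smul_eq_mul, show f x * (Q.eval x * g x) - Q.eval x * p.eval x * g x =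
          -((p.eval x - f x) * (Q.eval x * g x)) by ring, norm_neg, Real.norm_eq_abs, abs_mul]
        exact mul_le_mul_of_nonneg_right (hp x hx).le (abs_nonneg _)
      have hmeas : AEStronglyMeasurable
          (fun x => f x • (Q.eval x * g x) - (Q * p).eval x * g x) μ :=
        (hf.continuous.aestronglyMeasurable.smul hQg1.aestronglyMeasurable).sub
          (hQg p).aestronglyMeasurable
      have hint : Integrable (fun x => f x • (Q.eval x * g x) - (Q * p).eval x * g x) μ :=
        (hQg1.abs.const_mul ε).mono' hmeas hsub
      have hfint : Integrable (fun x => f x • (Q.eval x * g x)) μ := by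
        refine (hint.add (hQg p)).congr (Filter.Eventually.of_forall fun x => ?_)
        simp only [Pi.add_apply, sub_add_cancel]
      have heq : ∫ x, f x • (Q.eval x * g x) ∂μ =
          ∫ x, (f x • (Q.eval x * g x) - (Q * p).eval x * g x) ∂μ := by
        rw [integral_sub hfint (hQg p), h p, sub_zero]
      rw [heq, hI, ← integral_const_mul, ← Real.norm_eq_abs]
      exact norm_integral_le_of_norm_le (hQg1.abs.const_mul ε) hsub
    by_contra hne
    have hpos : 0 < |∫ x, f x • (Q.eval x * g x) ∂μ| := abs_pos.2 hne
    -- Dividing by `I + 1` instead of `I` covers the case `I = 0`.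
    have := hbound (|∫ x, f x • (Q.eval x * g x) ∂μ| / (I + 1)) (by positivity)
    rw [div_mul_eq_mul_div, le_div_iff₀ (by positivity)] at this
    nlinarith
  filter_upwards [key, ae_eval_ne_zero hac hQ] with x h1 h2
  exact (mul_eq_zero.1 h1).resolve_left h2

/-- In a Hilbert space, density of a subspace means a trivial orthogonal complement, and it suffices
to test against the ideal. -/
theorem isCompleteFamily_of_ideal [IsFiniteMeasure μ]
    (hμ : ∀ᵐ x ∂μ, x ∈ Set.Icc (-1 : ℝ) 1) (hac : μ ≪ volume) {p : ℕ → ℝ[X]} {S : Set ℕ}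
    {Q : ℝ[X]} (hQ : Q ≠ 0) (h : ∀ r, Q * r ∈ Submodule.span ℝ (p '' S)) :
    IsCompleteFamily p S μ := by
  refine ⟨fun n _ => memLp_eval hμ _ _, ?_⟩
  set V := Submodule.span ℝ {g : Lp ℝ 2 μ | ∃ n ∈ S, g =ᵐ[μ] fun x => (p n).eval x} with hV
  have hmem : Submodule.span ℝ (p '' S) ≤ V.comap (polyLp hμ) := by
    refine Submodule.span_le.2 ?_
    rintro _ ⟨n, hn, rfl⟩
    exact Submodule.subset_span ⟨n, hn, coeFn_polyLp hμ _⟩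
  rw [Submodule.dense_iff_topologicalClosure_eq_top, Submodule.topologicalClosure_eq_top_iff,
    Submodule.eq_bot_iff]
  intro g hg
  rw [Lp.eq_zero_iff_ae_eq_zero]
  refine ae_eq_zero_of_integral_ideal_eq_zero hμ hac hQ (Lp.memLp g) fun r => ?_
  have h0 := (Submodule.mem_orthogonal V g).1 hg _ (hmem (h r))
  rw [L2.inner_def] at h0
  rw [← h0]
  refine integral_congr_ae ?_
  filter_upwards [coeFn_polyLp hμ (Q * r)] with x hx
  rw [hx]
  simp [mul_comm]

end Density

/-! ### The weight, its integrability, and orthogonality -/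

section Weight

variable {α β : ℝ} {F₁ F₂ : Finset ℕ}

/-- Splitting at `0` leaves at most one singular factor on each half. -/
theorem intervalIntegrable_jacobi_weight {a b : ℝ} (ha : -1 < a) (hb : -1 < b) :
    IntervalIntegrable (fun x : ℝ => (1 - x) ^ a * (1 + x) ^ b) volume (-1) 1 := by
  have h1 : IntervalIntegrable (fun x : ℝ => (1 - x) ^ a * (1 + x) ^ b) volume (-1) 0 := by
    have h : IntervalIntegrable (fun x : ℝ => (1 + x) ^ b) volume (-1) 0 := by
      have := (intervalIntegral.intervalIntegrable_rpow' hb (a := 0) (b := 1)).comp_add_left 1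
      simpa using this
    refine h.continuousOn_mul (ContinuousOn.rpow_const (by fun_prop) fun x hx => Or.inl ?_)
    rw [Set.uIcc_of_le (by norm_num)] at hx
    have := hx.2
    linarith
  have h2 : IntervalIntegrable (fun x : ℝ => (1 - x) ^ a * (1 + x) ^ b) volume 0 1 := by
    have h : IntervalIntegrable (fun x : ℝ => (1 - x) ^ a) volume 0 1 := by
      have := (intervalIntegral.intervalIntegrable_rpow' ha (a := 1) (b := 0)).comp_sub_left 1
      simpa using this
    refine h.mul_continuousOn (ContinuousOn.rpow_const (by fun_prop) fun x hx => Or.inl ?_)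
    rw [Set.uIcc_of_le (by norm_num)] at hx
    have := hx.1
    linarith
  exact h1.trans h2

theorem weight_pos (hΩ : ∀ x ∈ Set.Icc (-1 : ℝ) 1, (omega α β F₁ F₂).eval x ≠ 0) {x : ℝ}
    (hx : x ∈ Set.Ioo (-1 : ℝ) 1) : 0 < weight α β F₁ F₂ x := by
  have h1 : 0 < 1 - x := by linarith [hx.2]
  have h2 : 0 < 1 + x := by linarith [hx.1]
  have h3 := hΩ x (Set.Ioo_subset_Icc_self hx)
  unfold weight
  positivity

theorem measurable_weight : Measurable (weight α β F₁ F₂) := by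
  unfold weight
  have := (omega α β F₁ F₂).continuous.measurable
  fun_prop

theorem intervalIntegrable_weight (hα : 0 < α + (F₁.card + F₂.card : ℕ) + 1)
    (hβ : 0 < β + F₁.card - F₂.card + 1)
    (hΩ : ∀ x ∈ Set.Icc (-1 : ℝ) 1, (omega α β F₁ F₂).eval x ≠ 0) :
    IntervalIntegrable (weight α β F₁ F₂) volume (-1) 1 := by
  have h := intervalIntegrable_jacobi_weight (a := α + (F₁.card + F₂.card : ℕ))
    (b := β + F₁.card - F₂.card) (by linarith) (by linarith)
  have h2 := h.mul_continuousOn (g := fun x => (((omega α β F₁ F₂).eval x) ^ 2)⁻¹) (by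
    rw [Set.uIcc_of_le (by norm_num)]
    exact ContinuousOn.inv₀ (by fun_prop) fun x hx => pow_ne_zero _ (hΩ x hx))
  refine h2.congr fun x _ => ?_
  rw [weight, div_eq_mul_inv]

theorem integrableOn_weight (hα : 0 < α + (F₁.card + F₂.card : ℕ) + 1)
    (hβ : 0 < β + F₁.card - F₂.card + 1)
    (hΩ : ∀ x ∈ Set.Icc (-1 : ℝ) 1, (omega α β F₁ F₂).eval x ≠ 0) :
    IntegrableOn (weight α β F₁ F₂) (Set.Ioo (-1) 1) :=
  ((intervalIntegrable_iff_integrableOn_Ioc_of_le (by norm_num)).1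
    (intervalIntegrable_weight hα hβ hΩ)).mono_set Set.Ioo_subset_Ioc_self

theorem weightMeasure_absolutelyContinuous : weightMeasure α β F₁ F₂ ≪ volume :=
  (withDensity_absolutelyContinuous _ _).trans Measure.restrict_le_self.absolutelyContinuous

theorem ae_weightMeasure_mem : ∀ᵐ x ∂weightMeasure α β F₁ F₂, x ∈ Set.Icc (-1 : ℝ) 1 := by
  refine (withDensity_absolutelyContinuous _ _).ae_le ?_
  filter_upwards [ae_restrict_mem measurableSet_Ioo] with x hx using Set.Ioo_subset_Icc_self hx

theorem weightMeasure_ne_zero (hΩ : ∀ x ∈ Set.Icc (-1 : ℝ) 1, (omega α β F₁ F₂).eval x ≠ 0) :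
    weightMeasure α β F₁ F₂ ≠ 0 := by
  intro h0
  rw [weightMeasure, withDensity_eq_zero_iff measurable_weight.ennreal_ofReal.aemeasurable] at h0
  have h : ∀ᵐ x ∂(volume.restrict (Set.Ioo (-1 : ℝ) 1)), False := by
    filter_upwards [h0, ae_restrict_mem measurableSet_Ioo] with x hx hmem
    exact (ENNReal.ofReal_pos.2 (weight_pos hΩ hmem)).ne' hx
  rw [Filter.eventually_false_iff_eq_bot, ae_eq_bot, Measure.restrict_eq_zero,
    Real.volume_Ioo] at h
  norm_num at h

theorem integral_weightMeasure
    (hΩ : ∀ x ∈ Set.Icc (-1 : ℝ) 1, (omega α β F₁ F₂).eval x ≠ 0) (f : ℝ → ℝ) :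
    ∫ x, f x ∂weightMeasure α β F₁ F₂ = ∫ x in (-1)..1, weight α β F₁ F₂ x * f x := by
  rw [intervalIntegral.integral_of_le (by norm_num), integral_Ioc_eq_integral_Ioo, weightMeasure,
    integral_withDensity_eq_integral_toReal_smul measurable_weight.ennreal_ofReal
      (Filter.Eventually.of_forall fun _ => ENNReal.ofReal_lt_top)]
  refine setIntegral_congr_fun measurableSet_Ioo fun x hx => ?_
  rw [ENNReal.toReal_ofReal (weight_pos hΩ hx).le, smul_eq_mul]

theorem integral_weight_mul_eq_zero (hk : 0 < F₁.card + F₂.card)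
    (hα : 0 < α + (F₁.card + F₂.card : ℕ) + 1) (hβ : 0 < β + F₁.card - F₂.card + 1)
    (hΩ : ∀ x ∈ Set.Icc (-1 : ℝ) 1, (omega α β F₁ F₂).eval x ≠ 0)
    (hαβ : ∀ m : ℕ, 1 ≤ m → α + β ≠ -m) {n m : ℕ} (hnm : n ≠ m) :
    ∫ x in (-1)..1, weight α β F₁ F₂ x * ((transform α β F₁ F₂ (jacobi n α β)).eval x *
      (transform α β F₁ F₂ (jacobi m α β)).eval x) = 0 := by
  set y := transform α β F₁ F₂ (jacobi n α β) with hy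
  set z := transform α β F₁ F₂ (jacobi m α β) with hz
  set W := y * derivative z - z * derivative y with hW
  have hconc := transform_concomitant hk (hΩ 0 (by norm_num)) n m hy hz hW
  set N := omega α β F₁ F₂ with hN
  set c : ℝ := n * (n + α + β + 1) - m * (m + α + β + 1) with hc
  set a : ℝ := α + (F₁.card + F₂.card : ℕ) with ha
  set b : ℝ := β + F₁.card - F₂.card with hb
  have hc0 : c ≠ 0 := by
    rw [show c = (n - m) * (n + m + α + β + 1) by rw [hc]; ring]
    refine mul_ne_zero (sub_ne_zero.2 (Nat.cast_injective.ne hnm)) fun h => ?_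
    exact hαβ (n + m + 1) (by omega) (by push_cast; linarith)
  -- The integrating factor of `transform_concomitant`: `(1 - x²)` times the logarithmic derivative
  -- of `(1 - x)^(a+1) (1 + x)^(b+1)` is `(b - a) - (a + b + 2) x`, the first order coefficient
  -- there.
  set G : ℝ → ℝ := fun x => (1 - x) ^ (a + 1) * (1 + x) ^ (b + 1) * (W.eval x / N.eval x ^ 2)
    with hG
  have hcont : ContinuousOn G (Set.Icc (-1) 1) := by
    have h1 : Continuous fun x : ℝ => (1 - x) ^ (a + 1) :=
      (by fun_prop : Continuous fun x : ℝ => 1 - x).rpow_const fun x => Or.inr hα.le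
    have h2 : Continuous fun x : ℝ => (1 + x) ^ (b + 1) :=
      (by fun_prop : Continuous fun x : ℝ => 1 + x).rpow_const fun x => Or.inr hβ.le
    exact (h1.mul h2).continuousOn.mul
      (W.continuous.continuousOn.div (by fun_prop) fun x hx => pow_ne_zero _ (hΩ x hx))
  have hderiv : ∀ x ∈ Set.Ioo (-1 : ℝ) 1,
      HasDerivAt G (c * (weight α β F₁ F₂ x * (y.eval x * z.eval x))) x := by
    intro x hx
    have hx1 : 0 < 1 - x := by linarith [hx.2]
    have hx2 : 0 < 1 + x := by linarith [hx.1]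
    have hN0 : N.eval x ≠ 0 := hΩ x (Set.Ioo_subset_Icc_self hx)
    have d1 := ((hasDerivAt_id x).const_sub 1).rpow_const (p := a + 1) (Or.inl hx1.ne')
    have d2 := ((hasDerivAt_id x).const_add 1).rpow_const (p := b + 1) (Or.inl hx2.ne')
    have d3 := (W.hasDerivAt x).div ((N.hasDerivAt x).pow 2) (pow_ne_zero _ hN0)
    have d := (d1.mul d2).mul d3
    refine d.congr_deriv ?_
    have he := congrArg (eval x) hconc
    simp only [eval_add, eval_sub, eval_mul, eval_pow, eval_X, eval_one, eval_C,
      eval_ofNat] at he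
    have hab1 : β - α - 2 * F₂.card = b - a := by rw [ha, hb]; push_cast; ring
    have hab2 : α + β + 2 + 2 * F₁.card = a + b + 2 := by rw [ha, hb]; push_cast; ring
    rw [hab1, hab2] at he
    simp only [weight, id, ← ha, ← hb, ← hN, Real.rpow_add_one hx1.ne', Real.rpow_add_one hx2.ne',
      add_sub_cancel_right, Pi.pow_apply, Pi.mul_apply, Pi.div_apply, Nat.cast_ofNat]
    field_simp
    linear_combination N.eval x * he
  have hint : IntervalIntegrable
      (fun x => c * (weight α β F₁ F₂ x * (y.eval x * z.eval x))) volume (-1) 1 :=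
    ((intervalIntegrable_weight hα hβ hΩ).mul_continuousOn (by fun_prop)).const_mul c
  have h := intervalIntegral.integral_eq_sub_of_hasDerivAt_of_le (by norm_num) hcont hderiv hint
  rw [intervalIntegral.integral_const_mul] at h
  -- The exponents `a + 1` and `b + 1` are positive, so both boundary values vanish.
  have hG0 : G 1 - G (-1) = 0 := by
    simp [hG, Real.zero_rpow hα.ne', Real.zero_rpow hβ.ne']
  rw [hG0] at h
  exact (mul_eq_zero.1 h).resolve_left hc0

end Weight

end ExceptionalJacobi

end

/-! ### The theorem -/

open ExceptionalJacobi
theorem theorem6p3 (F₁ F₂ : Finset ℕ) (hF₁ : ∀ f ∈ F₁, 0 < f) (hF₂ : ∀ f ∈ F₂, 0 < f)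
    (hF : F₁.Nonempty ∨ F₂.Nonempty) (α β : ℝ)
    (hpar : ∀ m : ℕ, 1 ≤ m → α ≠ -m ∧ β ≠ -m ∧ α + β ≠ -m)
    (hpar₂ : ∀ h : F₂.Nonempty, ∀ m : ℕ, 1 ≤ m → α - β ≠ -m ∧ β - (F₂.max' h : ℕ) - 1 ≠ -m)
    (hα : 0 < α + (F₁.card + F₂.card : ℕ) + 1)
    (hβ : 0 < β + F₁.card - F₂.card + 1)
    (hΩ : ∀ x ∈ Set.Icc (-1 : ℝ) 1, (omega α β F₁ F₂).eval x ≠ 0) :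
    ((1 + Polynomial.X) ^ (F₂.card * (F₂.card - 1)) ∣ (omegaMatrix α β F₁ F₂).det ∧
      ∀ n ∈ sigmaF F₁ F₂,
        (1 + Polynomial.X) ^ (F₂.card * (F₂.card - 1)) ∣ (excMatrix α β F₁ F₂ n).det) ∧
    (∀ x ∈ Set.Ioo (-1 : ℝ) 1, 0 < weight α β F₁ F₂ x) ∧
    IsOrthogonalFamily (excJacobi α β F₁ F₂) (sigmaF F₁ F₂) (weightMeasure α β F₁ F₂) ∧
    IsCompleteFamily (excJacobi α β F₁ F₂) (sigmaF F₁ F₂) (weightMeasure α β F₁ F₂) ∧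
    IsExceptionalJacobi α β F₁ F₂ := by
  have hk : 0 < F₁.card + F₂.card := by
    rcases hF with h | h
    · have := h.card_pos
      omega
    · have := h.card_pos
      omega
  have hΩ0 : (omega α β F₁ F₂).eval 0 ≠ 0 := hΩ 0 (by norm_num)
  have : IsFiniteMeasure (weightMeasure α β F₁ F₂) :=
    isFiniteMeasure_withDensity_ofReal (integrableOn_weight hα hβ hΩ).2
  have horth : IsOrthogonalFamily (excJacobi α β F₁ F₂) (sigmaF F₁ F₂)
      (weightMeasure α β F₁ F₂) := by
    refine ⟨fun m => ?_, fun n hn m hm hnm => ?_, fun n hn => ?_⟩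
    · simpa using (memLp_eval ae_weightMeasure_mem (Polynomial.X ^ m) 1).integrable le_rfl
    · rw [integral_weightMeasure hΩ]
      -- Both indices are at least `uF F₁ F₂`, so the truncated subtraction keeps them distinct.
      have h1 := hn.1
      have h2 := hm.1
      exact integral_weight_mul_eq_zero hk hα hβ hΩ (fun m hm => (hpar m hm).2.2)
        (by omega)
    · have hne : excJacobi α β F₁ F₂ n ≠ 0 := by
        refine transform_jacobi_ne_zero hk hΩ0 (fun m hm => (hpar m hm).1)
          (fun m hm => (hpar m hm).2.2) (fun h m hm => (hpar₂ h m hm).2) fun hmem => ?_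
        refine hn.2 _ hmem ?_
        have := hn.1
        omega
      exact integral_sq_pos_of_ne_zero ae_weightMeasure_mem weightMeasure_absolutelyContinuous
        (weightMeasure_ne_zero hΩ) hne
  have hcomp : IsCompleteFamily (excJacobi α β F₁ F₂) (sigmaF F₁ F₂)
      (weightMeasure α β F₁ F₂) := by
    obtain ⟨Q, hQ, h⟩ := exists_mul_mem_span hk hΩ0 (fun m hm => (hpar m hm).2.1)
      (fun m hm => (hpar m hm).2.2)
    exact isCompleteFamily_of_ideal ae_weightMeasure_mem weightMeasure_absolutelyContinuous hQ h
  exact ⟨⟨one_add_X_pow_dvd_det_omegaMatrix α β F₁ F₂,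
    fun n _ => one_add_X_pow_dvd_det_opMatrix α β F₁ F₂ _⟩, fun x hx => weight_pos hΩ hx, horth,
    hcomp, _, horth, hcomp⟩
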